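/- **Wiring diagrams.** A wiring diagram $G$ on the torus $\mathbb T=\mathbb R^2/\mathbb Z^2$ consists of finitely many directed closed wires ($C^1$ immersed closed curves) such that all crossings and self-crossings are transverse and exactly two strands pass through each crossing. The crossings are called vertices. A *face* of $G$ is an area of $\mathbb T$ surrounded by wires, i.e. a connected component of the complement of the wires that lifts to a bounded region of the universal cover $\mathbb R^2$ (as every open disc component does). A face is *oriented* if its boundary is oriented, i.e. either it lies on the left of every boundary edge and on the right of none, or it lies on the right of every boundary edge and on the left of none, with respect to the directions of the wires. **Green arrows and operations.** Fix a fundamental domain of the torus, namely a parallelogram whose east and north sides form a positively oriented basis of $\mathbb Z^2$ and whose boundary contains no vertex of $G$; name its corners SW, SE, NE, NW. A green arrow is a simple path in the closed fundamental domain from NW to SE that passes through no vertex. The *NE arrow* (resp. *SW arrow*) is the one that runs along the boundary via the corner NE (resp. SW). Green arrows are considered up to isotopy relative to the wires. The eight operations move a piece of a green arrow from the NE side of a small embedded (orientation-preserving) square to its SW side, both pieces running from the NW to the SE corner of the square, where inside the square the wires look as follows. * (o), (h), (v), (t): one horizontal and one vertical wire cross at the centre, so that the arrow passes over one vertex. Their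 directions are east and north for (o), west and north for (h), east and south for (v), west and south for (t). * (I), (I'): a single wire, which meets the arrow twice before the operation and not at all after it. It is directed from NW to SE for (I) and from SE to NW for (I'). * (iI), (iI'): a single wire, which does not meet the arrow before the operation and meets it twice after it. It is directed from NW to SE for (iI) and from SE to NW for (iI'). The operations are divided into type A: (v), (I), (iI); type B: (h), (I'), (iI'); type C: (o), (t). The diagram $G$ is *admissible* (with respect to the fundamental domain) if the NE arrow can be transformed into the SW arrow by a finite sequence of these operations in which operations of type A and of type B do not both occur. **Proposition.** If a wiring diagram $G$ on the torus has at least one oriented face, then $G$ is not admissible, for any choice of the fundamental domain. -/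

import Mathlib

open Set Topology Filter

/-! Wiring diagrams on the torus `ℂ / ℤ[i]`.  All curves and regions of the torus are described
through their lifts to the universal cover `ℂ`. -/

/-- Two parameters (a wire together with a time) are the same point of the same closed wire. -/
def SameParam {n : ℕ} (a b : Fin n × ℝ) : Prop :=
  a.1 = b.1 ∧ ∃ k : ℤ, a.2 = b.2 + k

/-- A wiring diagram on the torus `ℂ / ℤ[i]`: finitely many directed closed wires, which are
`C¹` immersed closed curves (each given by a lift to the plane), such that crossings and
self-crossings are transverse, and only two strands pass through each crossing. -/
structure WiringDiagram where
  /-- the number of wires -/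
  n : ℕ
  /-- a lift of each wire to the plane; the direction of the wire is that of increasing time -/
  wire : Fin n → ℝ → ℂ
  /-- the homology class of each wire -/
  period : Fin n → GaussianInt
  wire_add_one : ∀ i t, wire i (t + 1) = wire i t + (period i : ℂ)
  contDiff : ∀ i, ContDiff ℝ 1 (wire i)
  deriv_ne_zero : ∀ i t, deriv (wire i) t ≠ 0
  transverse : ∀ (a b : Fin n × ℝ) (l : GaussianInt),
    wire a.1 a.2 = wire b.1 b.2 + (l : ℂ) → ¬ SameParam a b →
      LinearIndependent ℝ ![deriv (wire a.1) a.2, deriv (wire b.1) b.2]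
  no_triple : ∀ (a b c : Fin n × ℝ) (l m : GaussianInt),
    wire a.1 a.2 = wire b.1 b.2 + (l : ℂ) → wire a.1 a.2 = wire c.1 c.2 + (m : ℂ) →
      SameParam a b ∨ SameParam a c ∨ SameParam b c

namespace WiringDiagram

/-- The preimage in the plane of the union of all wires. -/
def support (G : WiringDiagram) : Set ℂ :=
  {z | ∃ (i : Fin G.n) (t : ℝ) (l : GaussianInt), G.wire i t + (l : ℂ) = z}

/-- The point of the torus below `z` is a vertex (a crossing of two strands). -/
def IsVertex (G : WiringDiagram) (z : ℂ) : Prop :=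
  ∃ (a b : Fin G.n × ℝ) (l m : GaussianInt), ¬ SameParam a b ∧
    G.wire a.1 a.2 + (l : ℂ) = z ∧ G.wire b.1 b.2 + (m : ℂ) = z

/-- `F` is a lift to the plane of a face: an area of the torus surrounded by wires.  Thus `F` is a
connected component of the complement of the lifted wires, and being surrounded means that `F` is
bounded (this holds for all faces that are discs, and it excludes a face that contains a
noncontractible loop of the torus, such as the annulus between two parallel wires). -/
def IsFace (G : WiringDiagram) (F : Set ℂ) : Prop :=
  (∃ z ∈ G.supportᶜ, F = connectedComponentIn G.supportᶜ z) ∧ Bornology.IsBounded F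

/-- `F` lies on the left, and not on the right, of each edge on its boundary: the boundary is
directed counterclockwise. -/
def BoundaryPositive (G : WiringDiagram) (F : Set ℂ) : Prop :=
  ∀ (i : Fin G.n) (t : ℝ) (l : GaussianInt),
    G.wire i t + (l : ℂ) ∈ frontier F → ¬ G.IsVertex (G.wire i t + (l : ℂ)) →
      (∀ᶠ ε : ℝ in 𝓝[>] 0, G.wire i t + (l : ℂ) + ε * (Complex.I * deriv (G.wire i) t) ∈ F) ∧
      (∀ᶠ ε : ℝ in 𝓝[>] 0, G.wire i t + (l : ℂ) - ε * (Complex.I * deriv (G.wire i) t) ∉ F)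

/-- `F` lies on the right, and not on the left, of each edge on its boundary: the boundary is
directed clockwise. -/
def BoundaryNegative (G : WiringDiagram) (F : Set ℂ) : Prop :=
  ∀ (i : Fin G.n) (t : ℝ) (l : GaussianInt),
    G.wire i t + (l : ℂ) ∈ frontier F → ¬ G.IsVertex (G.wire i t + (l : ℂ)) →
      (∀ᶠ ε : ℝ in 𝓝[>] 0, G.wire i t + (l : ℂ) + ε * (Complex.I * deriv (G.wire i) t) ∉ F) ∧
      (∀ᶠ ε : ℝ in 𝓝[>] 0, G.wire i t + (l : ℂ) - ε * (Complex.I * deriv (G.wire i) t) ∈ F)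

/-- A face whose boundary is oriented, in one of the two ways. -/
def IsOrientedFace (G : WiringDiagram) (F : Set ℂ) : Prop :=
  G.IsFace F ∧ (G.BoundaryPositive F ∨ G.BoundaryNegative F)

end WiringDiagram

/-! The model square, whose corners NW, NE, SE, SW are `I`, `1 + I`, `1`, `0`. -/

/-- The closed unit square. -/
def unitSquare : Set ℂ := {z | 0 ≤ z.re ∧ z.re ≤ 1 ∧ 0 ≤ z.im ∧ z.im ≤ 1}

/-- The open unit square. -/
def openUnitSquare : Set ℂ := {z | 0 < z.re ∧ z.re < 1 ∧ 0 < z.im ∧ z.im < 1}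

/-- The part of the boundary that leads from NW to SE through the corner NE. -/
def northEast : Set ℂ := {z | z ∈ unitSquare ∧ (z.re = 1 ∨ z.im = 1)}

/-- The part of the boundary that leads from NW to SE through the corner SW. -/
def southWest : Set ℂ := {z | z ∈ unitSquare ∧ (z.re = 0 ∨ z.im = 0)}

/-- A fundamental domain of the torus whose boundary contains no vertex of `G`: the
parallelogram with SW corner `corner` and sides `east`, `north`, which form a positively oriented
basis of the lattice `ℤ[i]`. -/
structure FundamentalDomain (G : WiringDiagram) where
  corner : ℂ
  east : GaussianInt
  north : GaussianInt
  det_eq_one : east.re * north.im - east.im * north.re = 1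
  not_isVertex : ∀ z ∈ northEast ∪ southWest,
    ¬ G.IsVertex (corner + z.re * (east : ℂ) + z.im * (north : ℂ))

namespace FundamentalDomain

variable {G : WiringDiagram}

/-- The affine parametrization of the fundamental domain by the unit square. -/
noncomputable def param (D : FundamentalDomain G) (z : ℂ) : ℂ :=
  D.corner + z.re * (D.east : ℂ) + z.im * (D.north : ℂ)

/-- The (closed) fundamental domain. -/
def region (D : FundamentalDomain G) : Set ℂ := D.param '' unitSquare

/-- `g`, restricted to `[0, 1]`, is a green arrow: a simple path in the fundamental domain from
the corner NW to the corner SE that does not pass through a vertex. -/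
structure IsArrow (D : FundamentalDomain G) (g : ℝ → ℂ) : Prop where
  continuousOn : ContinuousOn g (Icc 0 1)
  injOn : InjOn g (Icc 0 1)
  mapsTo : MapsTo g (Icc 0 1) D.region
  start : g 0 = D.param Complex.I
  finish : g 1 = D.param 1
  not_isVertex : ∀ s ∈ Icc (0 : ℝ) 1, ¬ G.IsVertex (g s)

/-- The initial arrow, which goes from NW to SE along the boundary via the corner NE. -/
def IsNEArrow (D : FundamentalDomain G) (g : ℝ → ℂ) : Prop :=
  D.IsArrow g ∧ g '' Icc 0 1 = D.param '' northEast

/-- The final arrow, which goes from NW to SE along the boundary via the corner SW. -/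
def IsSWArrow (D : FundamentalDomain G) (g : ℝ → ℂ) : Prop :=
  D.IsArrow g ∧ g '' Icc 0 1 = D.param '' southWest

/-- The arrow `g'` is obtained from the arrow `g` by replacing one piece of it, which is the
side `northEast` of a square embedded by `ψ` in the fundamental domain, by the side `southWest`
of the same embedded square. -/
def Pushes (D : FundamentalDomain G) (ψ : ℂ → ℂ) (g g' : ℝ → ℂ) : Prop :=
  ContinuousOn ψ unitSquare ∧ InjOn ψ unitSquare ∧ MapsTo ψ unitSquare D.region ∧
  ∃ a b : ℝ, 0 ≤ a ∧ a < b ∧ b ≤ 1 ∧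
    (∀ s ∈ Icc (0 : ℝ) 1, s ∉ Ioo a b → g' s = g s) ∧
    g a = ψ Complex.I ∧ g b = ψ 1 ∧
    g '' Icc a b = ψ '' northEast ∧ g' '' Icc a b = ψ '' southWest

end FundamentalDomain

/-- The eight operations (o), (h), (v), (t), (I), (iI), (I'), (iI'). -/
inductive Operation where
  | o | h | v | t | I | iI | I' | iI'

/-- The three types of operations. -/
inductive OperationType where
  | A | B | C

namespace Operation

/-- The classification of the operations. -/
def type : Operation → OperationType
  | v => .A
  | I => .A
  | iI => .A
  | h => .B
  | I' => .B
  | iI' => .B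
  | o => .C
  | t => .C

/-- The local picture of an operation in the unit square, where the green arrow moves from
`northEast` to `southWest`: `op.Strand z d` says that a wire passes through `z` in the
direction `d`.
* (o), (h), (v), (t): a horizontal and a vertical wire cross at the centre;
* (I), (I'): a wire meets the green arrow twice before the operation and not after it;
* (iI), (iI'): a wire meets the green arrow twice after the operation and not before it.
In (I), (iI) the wire runs parallel to the green arrow, from NW to SE; in (I'), (iI') it runs
in the reversed direction. -/
def Strand : Operation → ℂ → ℂ → Prop
  | o, z, d => (z.im = 1 / 2 ∧ d = 1) ∨ (z.re = 1 / 2 ∧ d = Complex.I)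
  | h, z, d => (z.im = 1 / 2 ∧ d = -1) ∨ (z.re = 1 / 2 ∧ d = Complex.I)
  | v, z, d => (z.im = 1 / 2 ∧ d = 1) ∨ (z.re = 1 / 2 ∧ d = -Complex.I)
  | t, z, d => (z.im = 1 / 2 ∧ d = -1) ∨ (z.re = 1 / 2 ∧ d = -Complex.I)
  | I, z, d => z.re + z.im = 3 / 2 ∧ d = 1 - Complex.I
  | iI, z, d => z.re + z.im = 1 / 2 ∧ d = 1 - Complex.I
  | I', z, d => z.re + z.im = 3 / 2 ∧ d = -1 + Complex.I
  | iI', z, d => z.re + z.im = 1 / 2 ∧ d = -1 + Complex.I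

end Operation

namespace FundamentalDomain

variable {G : WiringDiagram}

/-- `g'` is obtained from `g` by the operation `op`: an embedded square, with an orientation
preserving `C¹` embedding of its interior, in which the directed wires look like the
local picture of `op`, and across which the green arrow moves. -/
def IsOperation (D : FundamentalDomain G) (op : Operation) (g g' : ℝ → ℂ) : Prop :=
  ∃ ψ : ℂ → ℂ, D.Pushes ψ g g' ∧
    ContDiffOn ℝ 1 ψ openUnitSquare ∧ (∀ z ∈ openUnitSquare, 0 < (fderiv ℝ ψ z).det) ∧
    (∀ z ∈ unitSquare, ψ z ∈ G.support ↔ ∃ d, op.Strand z d) ∧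
    ∀ z ∈ openUnitSquare, ∀ (i : Fin G.n) (t : ℝ) (l : GaussianInt),
      G.wire i t + (l : ℂ) = ψ z →
        ∃ d, op.Strand z d ∧ ∃ c : ℝ, 0 < c ∧ deriv (G.wire i) t = c * fderiv ℝ ψ z d

/-- `g'` is obtained from `g` by an elementary isotopy relative to the wires: the arrow moves
across an embedded square that either meets no wire, or is met by the wires in one
arc that crosses the arrow once before and once after the move.  (The embedding may reverse the
orientation, so the relation is symmetric.) -/
def IsIsotopy (D : FundamentalDomain G) (g g' : ℝ → ℂ) : Prop :=
  ∃ ψ : ℂ → ℂ, D.Pushes ψ g g' ∧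
    ((∀ z ∈ unitSquare, ψ z ∉ G.support) ∨
      ∀ z ∈ unitSquare, ψ z ∈ G.support ↔ z.re = z.im)

/-- The arrow `g` can be transformed into the last argument by isotopies and by
the listed operations, in this order. -/
inductive Transforms (D : FundamentalDomain G) (g : ℝ → ℂ) : List Operation → (ℝ → ℂ) → Prop
  | refl : D.IsArrow g → Transforms D g [] g
  | isotopy {ops : List Operation} {g₁ g₂ : ℝ → ℂ} :
      Transforms D g ops g₁ → D.IsArrow g₂ → D.IsIsotopy g₁ g₂ → Transforms D g ops g₂
  | operation {ops : List Operation} {g₁ g₂ : ℝ → ℂ} (op : Operation) :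
      Transforms D g ops g₁ → D.IsArrow g₂ → D.IsOperation op g₁ g₂ →
        Transforms D g (ops ++ [op]) g₂

end FundamentalDomain

/-- `G` is admissible (with respect to the fundamental domain `D`): the NE arrow can be
transformed into the SW arrow by a sequence of the eight operations in which types A and B do
not coexist. -/
def WiringDiagram.Admissible (G : WiringDiagram) (D : FundamentalDomain G) : Prop :=
  ∃ (g g' : ℝ → ℂ) (ops : List Operation), D.IsNEArrow g ∧ D.IsSWArrow g' ∧
    D.Transforms g ops g' ∧
    ¬ ((∃ op ∈ ops, op.type = .A) ∧ (∃ op ∈ ops, op.type = .B))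

/-! Let `F` be a lift of an oriented face, with `σ = 1` if it lies on the left of its boundary and
`σ = -1` if on the right. Take `σ = 1` and no operation of type B. In the square of an operation,
the only pieces of the complement of the wires that miss the side `northEast` are the south-west
quadrant at a crossing and the south-west corner cut off in (iI), (iI'). In types A and C the
directions put such a piece on the right of some edge, so it is not part of `F`
(`LocalPicture.exists_mem_northEast`). Hence `F` cannot appear: an arrow that avoids `F` keeps
avoiding it, and no square that it sweeps meets `F`. For the other choices of `σ` and of the missing
type, `F` likewise cannot appear, or, reading the moves backwards, cannot disappear.

An arrow that never sweeps `F` keeps its angle around each point of `F`, while the NE and SW arrows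
have angles differing by a full turn around an interior point of the domain
(`not_hasLogAlong_both_sides`). So the NE arrow must meet some lattice translate of `F`
(`exists_moves_across`). Equivalently, `F` meets the NE side of some translate of the domain. That
side is glued to SW sides of neighbouring translates, and since `F` cannot appear, it also meets the
NE side of such a neighbour. Iterating, `F` reaches arbitrarily far in one direction and is not
bounded (`not_of_propagates`). -/

/-! ### Continuous logarithms along paths -/

/-- The function `f` on `[0, 1]` has a continuous logarithm that leads from `w₀` to `w₁`. -/
def HasLogAlong (f : ℝ → ℂ) (w₀ w₁ : ℂ) : Prop :=
  ∃ θ : ℝ → ℂ, ContinuousOn θ (Icc 0 1) ∧ (∀ s ∈ Icc (0 : ℝ) 1, Complex.exp (θ s) = f s) ∧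
    θ 0 = w₀ ∧ θ 1 = w₁

/-- Two continuous logarithms of the same function on an interval differ by a constant. -/
theorem sub_eq_sub_of_exp_eq {a b : ℝ} {θ₁ θ₂ : ℝ → ℂ} (h₁ : ContinuousOn θ₁ (Icc a b))
    (h₂ : ContinuousOn θ₂ (Icc a b))
    (h : ∀ s ∈ Icc a b, Complex.exp (θ₁ s) = Complex.exp (θ₂ s)) {s : ℝ} (hs : s ∈ Icc a b) :
    θ₁ s - θ₂ s = θ₁ a - θ₂ a := by
  have ha : a ∈ Icc a b := ⟨le_rfl, hs.1.trans hs.2⟩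
  have hc : Complex.exp (θ₁ a - θ₂ a) = 1 := by
    rw [Complex.exp_sub, h a ha, div_self (Complex.exp_ne_zero _)]
  -- `θ₁` and the shift of `θ₂` by an element of the kernel of `exp` are lifts through the covering
  -- `exp` that agree at `a`.
  have := Complex.isCoveringMap_exp.eqOn_of_comp_eqOn (s := Icc a b) (g₁ := θ₁)
    (g₂ := fun s ↦ θ₂ s + (θ₁ a - θ₂ a)) isPreconnected_Icc h₁ (h₂.add continuousOn_const)
    (fun x hx ↦ Subtype.ext (by simp [Complex.exp_add, hc, h x hx])) ha (by ring)
  rw [this hs]; ring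

theorem HasLogAlong.endpoint_unique {f : ℝ → ℂ} {w₀ w₁ w₁' : ℂ} (h : HasLogAlong f w₀ w₁)
    (h' : HasLogAlong f w₀ w₁') : w₁ = w₁' := by
  obtain ⟨θ, hθ, hexp, rfl, rfl⟩ := h
  obtain ⟨θ', hθ', hexp', h0, rfl⟩ := h'
  have := sub_eq_sub_of_exp_eq hθ hθ' (fun s hs ↦ by rw [hexp s hs, hexp' s hs])
    (right_mem_Icc.2 zero_le_one)
  rw [h0, sub_self, sub_eq_zero] at this
  exact this

/-- Changing a path inside a set on which there is a continuous logarithm does not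
change the variation of the logarithm. -/
theorem HasLogAlong.replace {k M : ℂ → ℂ} {S : Set ℂ} (hM : ContinuousOn M S)
    (hexpM : ∀ w ∈ S, Complex.exp (M w) = k w) {g g' : ℝ → ℂ}
    (hg : ContinuousOn g (Icc 0 1)) (hg' : ContinuousOn g' (Icc 0 1)) {a b : ℝ}
    (ha : 0 ≤ a) (hab : a < b) (hb : b ≤ 1)
    (heq : ∀ s ∈ Icc (0 : ℝ) 1, s ∉ Ioo a b → g' s = g s)
    (hgS : ∀ s ∈ Icc a b, g s ∈ S) (hgS' : ∀ s ∈ Icc a b, g' s ∈ S) {w₀ w₁ : ℂ}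
    (h : HasLogAlong (fun s ↦ k (g s)) w₀ w₁) : HasLogAlong (fun s ↦ k (g' s)) w₀ w₁ := by
  classical
  obtain ⟨θ, hθ, hexp, rfl, rfl⟩ := h
  have hsub : Icc a b ⊆ Icc 0 1 := Icc_subset_Icc ha hb
  have hga : g' a = g a := heq a (hsub ⟨le_rfl, hab.le⟩) (fun h ↦ lt_irrefl _ h.1)
  have hgb : g' b = g b := heq b (hsub ⟨hab.le, le_rfl⟩) (fun h ↦ lt_irrefl _ h.2)
  have hMg : ContinuousOn (fun s ↦ M (g s)) (Icc a b) := hM.comp (hg.mono hsub) hgS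
  have hMg' : ContinuousOn (fun s ↦ M (g' s)) (Icc a b) := hM.comp (hg'.mono hsub) hgS'
  have key : ∀ s ∈ Icc a b, θ s - M (g s) = θ a - M (g a) := fun s hs ↦
    sub_eq_sub_of_exp_eq (hθ.mono hsub) hMg
      (fun x hx ↦ by rw [hexp x (hsub hx), hexpM _ (hgS x hx)]) hs
  have hc : Complex.exp (θ a - M (g a)) = 1 := by
    have ha' : a ∈ Icc a b := ⟨le_rfl, hab.le⟩
    rw [Complex.exp_sub, hexp a (hsub ha'), hexpM _ (hgS a ha'), div_self]
    change k (g a) ≠ 0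
    rw [← hexpM _ (hgS a ha')]
    exact Complex.exp_ne_zero _
  set c := θ a - M (g a) with hcdef
  -- The logarithm is replaced on `[a, b]` only; by `key` the same constant `c` makes both ends
  -- match.
  let θ' : ℝ → ℂ := fun s ↦ if s ∈ Icc a b then M (g' s) + c else θ s
  have hin : ∀ s ∈ Icc a b, θ' s = M (g' s) + c := fun s hs ↦ if_pos hs
  have hleft : ∀ s ∈ Icc 0 a, θ' s = θ s := by
    intro s hs
    by_cases hsa : s = a
    · subst hsa
      rw [hin s ⟨le_rfl, hab.le⟩, hga, hcdef]; ring
    · exact if_neg (fun h ↦ hsa (le_antisymm hs.2 h.1))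
  have hright : ∀ s ∈ Icc b 1, θ' s = θ s := by
    intro s hs
    by_cases hsb : s = b
    · subst hsb
      rw [hin s ⟨hab.le, le_rfl⟩, hgb, ← key s ⟨hab.le, le_rfl⟩]; ring
    · exact if_neg (fun h ↦ hsb (le_antisymm h.2 hs.1))
  refine ⟨θ', ?_, ?_, hleft 0 ⟨le_rfl, ha⟩, hright 1 ⟨hb, le_rfl⟩⟩
  · have h1 : ContinuousOn θ' (Icc 0 a) :=
      (hθ.mono (Icc_subset_Icc le_rfl (hab.le.trans hb))).congr hleft
    have h2 : ContinuousOn θ' (Icc a b) := (hMg'.add continuousOn_const).congr hin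
    have h3 : ContinuousOn θ' (Icc b 1) :=
      (hθ.mono (Icc_subset_Icc (ha.trans hab.le) le_rfl)).congr hright
    have h12 := h1.union_of_isClosed h2 isClosed_Icc isClosed_Icc
    rw [Icc_union_Icc_eq_Icc ha hab.le] at h12
    have h123 := h12.union_of_isClosed h3 isClosed_Icc isClosed_Icc
    rwa [Icc_union_Icc_eq_Icc (ha.trans hab.le) hb] at h123
  · intro s hs
    by_cases hsab : s ∈ Icc a b
    · rw [hin s hsab, Complex.exp_add, hc, mul_one, hexpM _ (hgS' s hsab)]
    · have : θ' s = θ s := if_neg hsab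
      rw [this, hexp s hs]
      dsimp only
      rw [heq s hs (fun h ↦ hsab (Ioo_subset_Icc_self h))]

/-! ### Logarithms on embedded squares -/

theorem isCompact_unitSquare : IsCompact unitSquare := by
  have : unitSquare = Icc 0 1 ×ℂ Icc 0 1 := by
    ext z; simp [unitSquare, Complex.mem_reProdIm, and_assoc]
  rw [this]
  exact isCompact_Icc.reProdIm isCompact_Icc

theorem convex_unitSquare : Convex ℝ unitSquare := by
  have : unitSquare = ({z | 0 ≤ z.re} ∩ {z | z.re ≤ 1}) ∩ ({z | 0 ≤ z.im} ∩ {z | z.im ≤ 1}) := by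
    ext z; simp [unitSquare, and_assoc]
  rw [this]
  exact ((convex_halfSpace_re_ge 0).inter (convex_halfSpace_re_le 1)).inter
    ((convex_halfSpace_im_ge 0).inter (convex_halfSpace_im_le 1))

/-- A continuous function without zeros on an embedded square has a continuous logarithm. -/
theorem exists_log_on_image_unitSquare {ψ k : ℂ → ℂ} (hψ : ContinuousOn ψ unitSquare)
    (hinj : InjOn ψ unitSquare) (hk : Continuous k) (hk0 : ∀ w ∈ ψ '' unitSquare, k w ≠ 0) :
    ∃ M : ℂ → ℂ, ContinuousOn M (ψ '' unitSquare) ∧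
      ∀ w ∈ ψ '' unitSquare, Complex.exp (M w) = k w := by
  -- The retraction of the plane onto the square makes `k ∘ ψ ∘ r` a zero-free function on a simply
  -- connected open set.
  let r : ℂ → ℂ := fun z ↦ ⟨max 0 (min 1 z.re), max 0 (min 1 z.im)⟩
  have hr : Continuous r := by
    have : r = fun z ↦ ((max 0 (min 1 z.re) : ℝ) : ℂ) + ((max 0 (min 1 z.im) : ℝ) : ℂ) * Complex.I := by
      ext z; simp [r, Complex.mk_eq_add_mul_I]
    rw [this]
    have := Complex.continuous_re
    have := Complex.continuous_im
    fun_prop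
  have hrm : ∀ z, r z ∈ unitSquare := fun z ↦ by simp [r, unitSquare]
  have hrid : ∀ z ∈ unitSquare, r z = z := by
    rintro z ⟨h1, h2, h3, h4⟩
    apply Complex.ext <;> simp [r, *]
  have hc : Continuous fun z ↦ k (ψ (r z)) := hk.comp (hψ.comp_continuous hr hrm)
  obtain ⟨L, hL, hexp⟩ := Complex.exists_continuousOn_eqOn_exp_comp (U := (univ : Set ℂ))
    (g := fun z ↦ k (ψ (r z)))
    ((Homeomorph.Set.univ ℂ).toHomotopyEquiv.simplyConnectedSpace_iff.2 inferInstance) isOpen_univ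
    hc.continuousOn (by
      rintro ⟨z, -, hz⟩
      exact hk0 _ ⟨_, hrm z, rfl⟩ hz)
  -- An injective continuous map on a compact set is closed onto its image.
  have hinv : ContinuousOn (Function.invFunOn ψ unitSquare) (ψ '' unitSquare) := by
    rw [continuousOn_iff_isClosed]
    refine fun t ht ↦ ⟨ψ '' (unitSquare ∩ t), ?_, ?_⟩
    · exact ((isCompact_unitSquare.inter_right ht).image_of_continuousOn
        (hψ.mono inter_subset_left)).isClosed
    · ext w
      constructor
      · rintro ⟨hw, z, hz, rfl⟩
        rw [mem_preimage, hinj.leftInvOn_invFunOn hz] at hw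
        exact ⟨⟨z, ⟨hz, hw⟩, rfl⟩, z, hz, rfl⟩
      · rintro ⟨⟨z, ⟨hz, hw⟩, rfl⟩, h⟩
        refine ⟨?_, h⟩
        rwa [mem_preimage, hinj.leftInvOn_invFunOn hz]
  refine ⟨fun w ↦ L (Function.invFunOn ψ unitSquare w), ?_, ?_⟩
  · exact hL.comp hinv (fun _ _ ↦ mem_univ _)
  · rintro _ ⟨z, hz, rfl⟩
    dsimp only
    rw [hinj.leftInvOn_invFunOn hz]
    have := hexp (mem_univ z)
    simpa [hrid z hz] using this

/-! ### The two ways around a point of the open square -/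

/-- Along the side `northEast` of the square and along the side `southWest`, the logarithm of the
distance vector to an interior point varies differently. -/
theorem not_hasLogAlong_both_sides {q : ℂ} (hq : q ∈ openUnitSquare) {g g' : ℝ → ℂ}
    (hg : ContinuousOn g (Icc 0 1)) (hg' : ContinuousOn g' (Icc 0 1))
    (hgm : ∀ s ∈ Icc (0 : ℝ) 1, g s ∈ northEast) (hgm' : ∀ s ∈ Icc (0 : ℝ) 1, g' s ∈ southWest)
    (h0 : g 0 = Complex.I) (h1 : g 1 = 1) (h0' : g' 0 = Complex.I) (h1' : g' 1 = 1) :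
    ∃ w₀ w₁, HasLogAlong (fun s ↦ (g s - q) * (1 - Complex.I)) w₀ w₁ ∧
      ¬ HasLogAlong (fun s ↦ (g' s - q) * (1 - Complex.I)) w₀ w₁ := by
  obtain ⟨hq1, hq2, hq3, hq4⟩ := hq
  -- The factor `1 - I` turns the north-east direction into the positive real axis. Vectors from `q`
  -- to `northEast` then avoid the negative axis, and those to `southWest` avoid the positive one.
  have hslit : ∀ s ∈ Icc (0 : ℝ) 1, (g s - q) * (1 - Complex.I) ∈ Complex.slitPlane := by
    intro s hs
    obtain ⟨⟨k1, k2, k3, k4⟩, h⟩ := hgm s hs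
    rw [Complex.mem_slitPlane_iff]
    simp only [Complex.mul_re, Complex.mul_im, Complex.sub_re, Complex.sub_im, Complex.one_re,
      Complex.one_im, Complex.I_re, Complex.I_im]
    by_contra! hcon
    rcases h with h | h <;> linarith [hcon.1, hcon.2]
  have hslit' : ∀ s ∈ Icc (0 : ℝ) 1, -((g' s - q) * (1 - Complex.I)) ∈ Complex.slitPlane := by
    intro s hs
    obtain ⟨⟨k1, k2, k3, k4⟩, h⟩ := hgm' s hs
    rw [Complex.mem_slitPlane_iff]
    simp only [Complex.neg_re, Complex.neg_im, Complex.mul_re, Complex.mul_im, Complex.sub_re,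
      Complex.sub_im, Complex.one_re, Complex.one_im, Complex.I_re, Complex.I_im]
    by_contra! hcon
    rcases h with h | h <;> linarith [hcon.1, hcon.2]
  set u₀ := (Complex.I - q) * (1 - Complex.I) with hu₀
  set u₁ := (1 - q) * (1 - Complex.I) with hu₁
  have him₀ : 0 < u₀.im := by simp [hu₀]; linarith
  have him₁ : u₁.im < 0 := by simp [hu₁]; linarith
  have hlog : HasLogAlong (fun s ↦ (g s - q) * (1 - Complex.I)) (Complex.log u₀)
      (Complex.log u₁) := by
    refine ⟨fun s ↦ Complex.log ((g s - q) * (1 - Complex.I)), ?_, ?_, by simp [h0, hu₀],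
      by simp [h1, hu₁]⟩
    · exact ContinuousOn.clog (by fun_prop) hslit
    · exact fun s hs ↦ Complex.exp_log (Complex.slitPlane_ne_zero (hslit s hs))
  -- The branch `log (-u) + π I` agrees with `log u` in the upper half plane, where `u₀` lies, and
  -- exceeds it by `2 π I` in the lower one, where `u₁` lies.
  have hlog' : HasLogAlong (fun s ↦ (g' s - q) * (1 - Complex.I)) (Complex.log u₀)
      (Complex.log u₁ + 2 * Real.pi * Complex.I) := by
    refine ⟨fun s ↦ Complex.log (-((g' s - q) * (1 - Complex.I))) + Real.pi * Complex.I,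
      ?_, ?_, ?_, ?_⟩
    · exact (ContinuousOn.clog (by fun_prop) hslit').add continuousOn_const
    · intro s hs
      dsimp only
      rw [Complex.exp_add, Complex.exp_pi_mul_I,
        Complex.exp_log (Complex.slitPlane_ne_zero (hslit' s hs))]
      ring
    · simp only [h0', ← hu₀, Complex.log, norm_neg,
        Complex.arg_neg_eq_arg_sub_pi_of_im_pos him₀]
      push_cast; ring
    · simp only [h1', ← hu₁, Complex.log, norm_neg,
        Complex.arg_neg_eq_arg_add_pi_of_im_neg him₁]
      push_cast; ring
  refine ⟨_, _, hlog, fun h ↦ ?_⟩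
  have := h.endpoint_unique hlog'
  have hpi : (2 * Real.pi * Complex.I : ℂ) ≠ 0 := Complex.two_pi_I_ne_zero
  exact hpi (by linear_combination -this)

/-! ### Regions on one side of their boundary -/

/-- The cross product of two vectors in the plane. -/
def cross (x y : ℂ) : ℝ := x.re * y.im - x.im * y.re

/-- This carries the notion of being to the left of a strand through the derivative of an
orientation-preserving embedding. -/
theorem cross_map (A : ℂ →L[ℝ] ℂ) (x y : ℂ) : cross (A x) (A y) = A.det * cross x y := by
  have hA : ∀ z : ℂ, A z = z.re * A 1 + z.im * A Complex.I := by
    intro z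
    conv_lhs => rw [← Complex.re_add_im z]
    have h1 : (z.re : ℂ) = z.re • (1 : ℂ) := by simp
    have h2 : (z.im : ℂ) * Complex.I = z.im • Complex.I := by simp
    rw [map_add, h2, h1, map_smul, map_smul]
    simp
  have hdet : A.det = cross (A 1) (A Complex.I) := by
    rw [ContinuousLinearMap.det, ← LinearMap.det_toMatrix Complex.basisOneI, Matrix.det_fin_two]
    simp [LinearMap.toMatrix_apply, cross]
    ring
  rw [hdet, hA x, hA y]
  simp [cross]
  ring

theorem cross_I_mul_self (x : ℂ) : cross x (Complex.I * x) = Complex.normSq x := by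
  simp [cross, Complex.normSq_apply]

namespace WiringDiagram

variable {G : WiringDiagram}

/-- `F` is a union of connected components of the complement of the lifted wires which does not
lie on the side `-σ` of an edge of its boundary, where the left side is `1` and the right
side is `-1`. -/
structure IsOneSided (G : WiringDiagram) (σ : ℝ) (F : Set ℂ) : Prop where
  disjoint : ∀ z ∈ F, z ∉ G.support
  subset : ∀ Q : Set ℂ, IsPreconnected Q → Q ⊆ G.supportᶜ → (Q ∩ F).Nonempty → Q ⊆ F
  side : ∀ (i : Fin G.n) (t : ℝ) (l : GaussianInt),
    G.wire i t + (l : ℂ) ∈ frontier F → ¬ G.IsVertex (G.wire i t + (l : ℂ)) →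
      ∀ᶠ ε : ℝ in 𝓝[>] 0,
        G.wire i t + (l : ℂ) + ε * (-σ * (Complex.I * deriv (G.wire i) t)) ∉ F

/-- Only the negative half of the boundary condition is kept, and the sign `σ` lets both
orientations be treated together. -/
theorem IsOrientedFace.isOneSided {F : Set ℂ} (hF : G.IsOrientedFace F) :
    G.IsOneSided 1 F ∨ G.IsOneSided (-1) F := by
  obtain ⟨⟨⟨z₀, hz₀, hFz⟩, -⟩, hor⟩ := hF
  have hdisj : ∀ z ∈ F, z ∉ G.support := fun z hz ↦
    connectedComponentIn_subset _ _ (hFz ▸ hz)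
  have hsub : ∀ Q : Set ℂ, IsPreconnected Q → Q ⊆ G.supportᶜ → (Q ∩ F).Nonempty → Q ⊆ F := by
    rintro Q hQ hQs ⟨z, hzQ, hzF⟩
    rw [hFz] at hzF ⊢
    rw [connectedComponentIn_eq hzF]
    exact hQ.subset_connectedComponentIn hzQ hQs
  refine hor.imp (fun h ↦ ⟨hdisj, hsub, fun i t l hf hv ↦ ?_⟩)
    fun h ↦ ⟨hdisj, hsub, fun i t l hf hv ↦ ?_⟩
  · filter_upwards [(h i t l hf hv).2] with ε hε
    convert! hε using 2
    push_cast; ring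
  · filter_upwards [(h i t l hf hv).1] with ε hε
    convert! hε using 2
    push_cast; ring

theorem support_add_iff (z : ℂ) (m : GaussianInt) : z + (m : ℂ) ∈ G.support ↔ z ∈ G.support := by
  constructor
  · rintro ⟨i, t, l, h⟩
    exact ⟨i, t, l - m, by rw [map_sub]; linear_combination h⟩
  · rintro ⟨i, t, l, h⟩
    exact ⟨i, t, l + m, by rw [map_add]; linear_combination h⟩

theorem IsVertex.add {z : ℂ} (h : G.IsVertex z) (m : GaussianInt) : G.IsVertex (z + (m : ℂ)) := by
  obtain ⟨a, b, l, k, hab, ha, hb⟩ := h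
  exact ⟨a, b, l + m, k + m, hab, by rw [map_add]; linear_combination ha,
    by rw [map_add]; linear_combination hb⟩

/-- Translates of one-sided regions by lattice vectors are one-sided. -/
theorem IsOneSided.translate {σ : ℝ} {F : Set ℂ} (hF : G.IsOneSided σ F) (m : GaussianInt) :
    G.IsOneSided σ ((fun z ↦ z + (m : ℂ)) ⁻¹' F) := by
  have hfr : frontier ((fun z ↦ z + (m : ℂ)) ⁻¹' F) = (fun z ↦ z + (m : ℂ)) ⁻¹' frontier F :=
    ((Homeomorph.addRight (m : ℂ)).preimage_frontier F).symm
  refine ⟨fun z hz h ↦ hF.disjoint _ hz ((support_add_iff z m).2 h), ?_, ?_⟩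
  · rintro Q hQ hQs ⟨z, hzQ, hzF⟩
    rw [← image_subset_iff]
    refine hF.subset _ (hQ.image _ (by fun_prop)) ?_ ⟨_, ⟨z, hzQ, rfl⟩, hzF⟩
    rintro _ ⟨w, hw, rfl⟩ h
    exact hQs hw ((support_add_iff w m).1 h)
  · intro i t l hf hv
    rw [hfr, mem_preimage] at hf
    have e : ∀ w : ℂ, G.wire i t + ((l + m : GaussianInt) : ℂ) + w
        = G.wire i t + (l : ℂ) + w + (m : ℂ) := fun w ↦ by rw [map_add]; ring
    have e0 : G.wire i t + ((l + m : GaussianInt) : ℂ) = G.wire i t + (l : ℂ) + (m : ℂ) := by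
      rw [map_add]; ring
    have := hF.side i t (l + m) (by rwa [e0]) (fun h ↦ hv (by
      have := h.add (-m)
      rw [e0, map_neg] at this
      simpa using this))
    filter_upwards [this] with ε hε
    rwa [e] at hε

/-- Let the wires near `ψ z₀` form the image of one strand in the direction `d` under an orientation
preserving embedding `ψ`.  Then a one-sided region does not contain the points on
the wrong side of the strand. -/
theorem IsOneSided.not_wrong_side {σ : ℝ} {F : Set ℂ} (hF : G.IsOneSided σ F) (hσ : σ ≠ 0)
    {ψ : ℂ → ℂ} {z₀ d : ℂ} (hψ : ContDiffAt ℝ 1 ψ z₀) (hdet : 0 < (fderiv ℝ ψ z₀).det)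
    (hz₀ : ψ z₀ ∈ G.support)
    (hd : ∀ (i : Fin G.n) (t : ℝ) (l : GaussianInt), G.wire i t + (l : ℂ) = ψ z₀ →
      ∃ c : ℝ, 0 < c ∧ deriv (G.wire i) t = c * fderiv ℝ ψ z₀ d)
    (hside : ∀ᶠ z in 𝓝 z₀, σ * cross d (z - z₀) < 0 → ψ z ∈ F) : False := by
  obtain ⟨i, t, l, hw⟩ := hz₀
  -- All branches through `ψ z₀` have velocities that are positive multiples of one vector, which
  -- excludes a transverse crossing.
  have hv : ¬ G.IsVertex (ψ z₀) := by
    rintro ⟨a, b, l, m, hab, ha, hb⟩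
    obtain ⟨ca, hca, hda⟩ := hd _ _ _ ha
    obtain ⟨cb, hcb, hdb⟩ := hd _ _ _ hb
    have hli := G.transverse a b (m - l) (by rw [map_sub]; linear_combination ha - hb) hab
    rw [LinearIndependent.pair_iff] at hli
    have := (hli cb (-ca) (by rw [hda, hdb]; simp only [Complex.real_smul]; push_cast; ring)).1
    exact hcb.ne' this
  obtain ⟨c, hc, hdc⟩ := hd i t l hw
  set A := fderiv ℝ ψ z₀ with hAdef
  let e := A.toContinuousLinearEquivOfDetNeZero hdet.ne'
  have hstrict : HasStrictFDerivAt ψ (e : ℂ →L[ℝ] ℂ) z₀ := by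
    rw [ContinuousLinearMap.coe_toContinuousLinearEquivOfDetNeZero]
    exact hψ.hasStrictFDerivAt one_ne_zero
  have he : ∀ x, e x = A x := fun x ↦ rfl
  -- `u₀` points to the forbidden side of the wire. As the determinant is positive, its pullback `u`
  -- points to the forbidden side of `d`.
  set u₀ : ℂ := -σ * (Complex.I * deriv (G.wire i) t) with hu₀
  set u := e.symm u₀ with hu
  have hAu : A u = u₀ := by rw [← he, hu, e.apply_symm_apply]
  have hAd : A d ≠ 0 := by
    intro h
    exact G.deriv_ne_zero i t (by rw [hdc, h, mul_zero])
  have hcross : σ * cross d u < 0 := by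
    have h1 : A.det * cross d u = -σ * c * Complex.normSq (A d) := by
      rw [← cross_map, hAu, hu₀, hdc, ← cross_I_mul_self]
      simp [cross]; ring
    have h2 : A.det * (σ * cross d u) = -(σ ^ 2 * c * Complex.normSq (A d)) := by
      linear_combination σ * h1
    have h3 : 0 < σ ^ 2 * c * Complex.normSq (A d) :=
      mul_pos (mul_pos (by positivity) hc) (Complex.normSq_pos.2 hAd)
    by_contra! hcon
    have := mul_nonneg hdet.le hcon
    linarith
  -- The side condition is tested along a straight segment in the plane, whereas `hside` lives in
  -- the square; `γ` is the pullback of the segment, with initial velocity `u`.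
  let γ : ℝ → ℂ := fun ε ↦ hstrict.localInverse ψ e z₀ (ψ z₀ + ε * u₀)
  have hline : HasDerivAt (fun ε : ℝ ↦ ψ z₀ + ε * u₀) u₀ 0 := by
    have := (((hasDerivAt_id (0 : ℝ)).ofReal_comp).mul_const u₀).const_add (ψ z₀)
    simpa using this
  have hγ : HasDerivAt γ u 0 := by
    have h := hstrict.to_localInverse.hasFDerivAt
    have h0 : ψ z₀ = (fun ε : ℝ ↦ ψ z₀ + ε * u₀) 0 := by simp
    rw [h0] at h
    exact h.comp_hasDerivAt (0 : ℝ) hline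
  have hγ0 : γ 0 = z₀ := by simp [γ]
  have hψγ : ∀ᶠ ε in 𝓝[>] (0 : ℝ), ψ (γ ε) = ψ z₀ + ε * u₀ := by
    have h := hstrict.eventually_right_inverse
    have ht : Tendsto (fun ε : ℝ ↦ ψ z₀ + ε * u₀) (𝓝[>] 0) (𝓝 (ψ z₀)) := by
      have := hline.continuousAt.tendsto
      simp only [Complex.ofReal_zero, zero_mul, add_zero] at this
      exact this.mono_left nhdsWithin_le_nhds
    exact ht.eventually h
  have hcrossγ : ∀ᶠ ε in 𝓝[>] (0 : ℝ), σ * cross d (γ ε - z₀) < 0 := by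
    have hslope := hγ.tendsto_slope_zero_right
    have hcont : Continuous fun z ↦ σ * cross d z := by
      have := Complex.continuous_re
      have := Complex.continuous_im
      unfold cross
      fun_prop
    have h := (hcont.tendsto u).comp hslope
    filter_upwards [h.eventually_lt_const hcross, self_mem_nhdsWithin] with ε hε hpos
    have hpos : 0 < ε := hpos
    simp only [Function.comp_apply, zero_add, hγ0] at hε
    have h2 : σ * cross d (ε⁻¹ • (γ ε - z₀)) = ε⁻¹ * (σ * cross d (γ ε - z₀)) := by
      simp [cross]; ring
    rw [h2] at hε
    by_contra! hcon
    have := mul_nonneg (inv_pos.2 hpos).le hcon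
    linarith
  have hγt : Tendsto γ (𝓝[>] 0) (𝓝 z₀) := by
    have := hγ.continuousAt.tendsto
    rw [hγ0] at this
    exact this.mono_left nhdsWithin_le_nhds
  have hmem : ∀ᶠ ε : ℝ in 𝓝[>] 0, ψ z₀ + ε * u₀ ∈ F := by
    filter_upwards [hψγ, hcrossγ, hγt.eventually hside] with ε h1 h2 h3
    rw [← h1]
    exact h3 h2
  have hfr : ψ z₀ ∈ frontier F := by
    refine ⟨?_, fun h ↦ hF.disjoint _ (interior_subset h) ⟨i, t, l, hw⟩⟩
    have ht : Tendsto (fun ε : ℝ ↦ ψ z₀ + ε * u₀) (𝓝[>] 0) (𝓝 (ψ z₀)) := by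
      have := hline.continuousAt.tendsto
      simp only [Complex.ofReal_zero, zero_mul, add_zero] at this
      exact this.mono_left nhdsWithin_le_nhds
    exact mem_closure_of_tendsto ht hmem
  have := hF.side i t l (by rwa [hw]) (by rwa [hw])
  rw [hw] at this
  obtain ⟨ε, h1, h2⟩ := (this.and hmem).exists
  exact h1 h2

end WiringDiagram

/-! ### One-sided regions and the local pictures of the operations -/

/-- Under the embedding `ψ` of the square, the wires of `G` look like the local picture of `op`. -/
structure LocalPicture (G : WiringDiagram) (op : Operation) (ψ : ℂ → ℂ) : Prop where
  continuousOn : ContinuousOn ψ unitSquare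
  contDiffOn : ContDiffOn ℝ 1 ψ openUnitSquare
  det_pos : ∀ z ∈ openUnitSquare, 0 < (fderiv ℝ ψ z).det
  mem_support_iff : ∀ z ∈ unitSquare, ψ z ∈ G.support ↔ ∃ d, op.Strand z d
  direction : ∀ z ∈ openUnitSquare, ∀ (i : Fin G.n) (t : ℝ) (l : GaussianInt),
    G.wire i t + (l : ℂ) = ψ z →
      ∃ d, op.Strand z d ∧ ∃ c : ℝ, 0 < c ∧ deriv (G.wire i) t = c * fderiv ℝ ψ z d

theorem isOpen_openUnitSquare : IsOpen openUnitSquare := by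
  have : openUnitSquare = Ioo 0 1 ×ℂ Ioo 0 1 := by
    ext z; simp [openUnitSquare, Complex.mem_reProdIm, and_assoc]
  rw [this]
  exact isOpen_Ioo.reProdIm isOpen_Ioo

theorem openUnitSquare_subset : openUnitSquare ⊆ unitSquare :=
  fun _ h ↦ ⟨h.1.le, h.2.1.le, h.2.2.1.le, h.2.2.2.le⟩

/-- The image of the convex set `unitSquare ∩ Q` is connected and avoids the wires, so it stays in
one component of their complement. -/
theorem WiringDiagram.IsOneSided.mem_of_convex {G : WiringDiagram} {σ : ℝ} {F : Set ℂ}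
    (hF : G.IsOneSided σ F) {ψ : ℂ → ℂ} (hψ : ContinuousOn ψ unitSquare) {Q : Set ℂ}
    (hQ : Convex ℝ Q) (hQs : ∀ z ∈ unitSquare ∩ Q, ψ z ∉ G.support) {z w : ℂ}
    (hz : z ∈ unitSquare) (hzQ : z ∈ Q) (hzF : ψ z ∈ F) (hw : w ∈ unitSquare) (hwQ : w ∈ Q) :
    ψ w ∈ F := by
  refine hF.subset (ψ '' (unitSquare ∩ Q)) ?_ ?_ ⟨_, ⟨z, ⟨hz, hzQ⟩, rfl⟩, hzF⟩
    ⟨w, ⟨hw, hwQ⟩, rfl⟩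
  · exact (convex_unitSquare.inter hQ).isPreconnected.image _ (hψ.mono inter_subset_left)
  · rintro _ ⟨x, hx, rfl⟩
    exact hQs x hx

namespace LocalPicture

variable {G : WiringDiagram} {op : Operation} {ψ : ℂ → ℂ} {σ : ℝ} {F : Set ℂ}

/-- The radius `1 / 4` is the distance from the points used below on a horizontal or vertical strand
to the strand that crosses it. -/
theorem not_wrong_side (P : LocalPicture G op ψ) (hF : G.IsOneSided σ F) (hσ : σ ≠ 0) {z₀ d : ℂ}
    (hz₀ : z₀ ∈ openUnitSquare) (hd : ∀ d', op.Strand z₀ d' ↔ d' = d)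
    (hside : ∀ z ∈ openUnitSquare, σ * cross d (z - z₀) < 0 → ‖z - z₀‖ < 1 / 4 → ψ z ∈ F) :
    False := by
  refine hF.not_wrong_side hσ (d := d)
    (P.contDiffOn.contDiffAt (isOpen_openUnitSquare.mem_nhds hz₀)) (P.det_pos _ hz₀)
    ((P.mem_support_iff _ (openUnitSquare_subset hz₀)).2 ⟨d, (hd d).2 rfl⟩) ?_ ?_
  · intro i t l h
    obtain ⟨d', hd', h'⟩ := P.direction _ hz₀ i t l h
    rwa [(hd d').1 hd'] at h'
  · filter_upwards [isOpen_openUnitSquare.mem_nhds hz₀,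
      Metric.ball_mem_nhds z₀ (show (0 : ℝ) < 1 / 4 by norm_num)] with z hz hz' hc
    exact hside z hz hc (by rwa [mem_ball_iff_norm] at hz')

/-! A one-sided region that contains a quadrant or a corner of the local picture. -/

/-- The test point is the midpoint of the half-wire bordering the quadrant, and the sign of `σ *
d.re` puts the quadrant on the forbidden side. The next five lemmas vary the wire and the quadrant
or corner. -/
theorem not_southWest_horizontal (P : LocalPicture G op ψ) (hF : G.IsOneSided σ F) (hσ : σ ≠ 0)
    (hQ : ∀ z ∈ unitSquare, z.re < 1 / 2 → z.im < 1 / 2 → ψ z ∈ F) {d : ℂ}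
    (hd : ∀ d', op.Strand ⟨1 / 4, 1 / 2⟩ d' ↔ d' = d) (him : d.im = 0) (hre : 0 < σ * d.re) :
    False := by
  refine P.not_wrong_side hF hσ (by norm_num [openUnitSquare]) hd fun z hz hc hn ↦
    hQ z (openUnitSquare_subset hz) ?_ ?_
  · have := (abs_lt.1 ((Complex.abs_re_le_norm _).trans_lt hn)).2
    norm_num at this; linarith
  · simp only [cross, him, Complex.sub_im, zero_mul, sub_zero] at hc
    nlinarith

theorem not_southWest_vertical (P : LocalPicture G op ψ) (hF : G.IsOneSided σ F) (hσ : σ ≠ 0)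
    (hQ : ∀ z ∈ unitSquare, z.re < 1 / 2 → z.im < 1 / 2 → ψ z ∈ F) {d : ℂ}
    (hd : ∀ d', op.Strand ⟨1 / 2, 1 / 4⟩ d' ↔ d' = d) (hre : d.re = 0) (him : σ * d.im < 0) :
    False := by
  refine P.not_wrong_side hF hσ (by norm_num [openUnitSquare]) hd fun z hz hc hn ↦
    hQ z (openUnitSquare_subset hz) ?_ ?_
  · simp only [cross, hre, Complex.sub_re, zero_mul, zero_sub] at hc
    nlinarith
  · have := (abs_lt.1 ((Complex.abs_im_le_norm _).trans_lt hn)).2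
    norm_num at this; linarith

theorem not_southWest_diagonal (P : LocalPicture G op ψ) (hF : G.IsOneSided σ F) (hσ : σ ≠ 0)
    (hQ : ∀ z ∈ unitSquare, z.re + z.im < 1 / 2 → ψ z ∈ F) {d : ℂ}
    (hd : ∀ d', op.Strand ⟨1 / 4, 1 / 4⟩ d' ↔ d' = d) (him : d.im = -d.re) (hre : 0 < σ * d.re) :
    False := by
  refine P.not_wrong_side hF hσ (by norm_num [openUnitSquare]) hd fun z hz hc hn ↦
    hQ z (openUnitSquare_subset hz) ?_
  simp only [cross, him, Complex.sub_re, Complex.sub_im] at hc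
  nlinarith

theorem not_northEast_horizontal (P : LocalPicture G op ψ) (hF : G.IsOneSided σ F) (hσ : σ ≠ 0)
    (hQ : ∀ z ∈ unitSquare, 1 / 2 < z.re → 1 / 2 < z.im → ψ z ∈ F) {d : ℂ}
    (hd : ∀ d', op.Strand ⟨3 / 4, 1 / 2⟩ d' ↔ d' = d) (him : d.im = 0) (hre : σ * d.re < 0) :
    False := by
  refine P.not_wrong_side hF hσ (by norm_num [openUnitSquare]) hd fun z hz hc hn ↦
    hQ z (openUnitSquare_subset hz) ?_ ?_
  · have := (abs_lt.1 ((Complex.abs_re_le_norm _).trans_lt hn)).1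
    norm_num at this; linarith
  · simp only [cross, him, Complex.sub_im, zero_mul, sub_zero] at hc
    nlinarith

theorem not_northEast_vertical (P : LocalPicture G op ψ) (hF : G.IsOneSided σ F) (hσ : σ ≠ 0)
    (hQ : ∀ z ∈ unitSquare, 1 / 2 < z.re → 1 / 2 < z.im → ψ z ∈ F) {d : ℂ}
    (hd : ∀ d', op.Strand ⟨1 / 2, 3 / 4⟩ d' ↔ d' = d) (hre : d.re = 0) (him : 0 < σ * d.im) :
    False := by
  refine P.not_wrong_side hF hσ (by norm_num [openUnitSquare]) hd fun z hz hc hn ↦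
    hQ z (openUnitSquare_subset hz) ?_ ?_
  · simp only [cross, hre, Complex.sub_re, zero_mul, zero_sub] at hc
    nlinarith
  · have := (abs_lt.1 ((Complex.abs_im_le_norm _).trans_lt hn)).1
    norm_num at this; linarith

theorem not_northEast_diagonal (P : LocalPicture G op ψ) (hF : G.IsOneSided σ F) (hσ : σ ≠ 0)
    (hQ : ∀ z ∈ unitSquare, 3 / 2 < z.re + z.im → ψ z ∈ F) {d : ℂ}
    (hd : ∀ d', op.Strand ⟨3 / 4, 3 / 4⟩ d' ↔ d' = d) (him : d.im = -d.re) (hre : σ * d.re < 0) :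
    False := by
  refine P.not_wrong_side hF hσ (by norm_num [openUnitSquare]) hd fun z hz hc hn ↦
    hQ z (openUnitSquare_subset hz) ?_
  simp only [cross, him, Complex.sub_re, Complex.sub_im] at hc
  nlinarith

/-! The components of the complement of the wires in the local pictures. -/

/-- If two wires cross in the square, then each region that meets the square contains the south-west
quadrant or a point of the side `northEast`. -/
theorem cross_southWest (P : LocalPicture G op ψ) (hF : G.IsOneSided σ F)
    (hop : ∀ z, (∃ d, op.Strand z d) ↔ z.im = 1 / 2 ∨ z.re = 1 / 2) {z : ℂ} (hz : z ∈ unitSquare)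
    (hzF : ψ z ∈ F) : (∃ w ∈ northEast, ψ w ∈ F) ∨
      ∀ w ∈ unitSquare, w.re < 1 / 2 → w.im < 1 / 2 → ψ w ∈ F := by
  have hns : ∀ w ∈ unitSquare, ψ w ∈ G.support ↔ w.im = 1 / 2 ∨ w.re = 1 / 2 := fun w hw ↦
    (P.mem_support_iff w hw).trans (hop w)
  have hz' := not_or.1 fun h ↦ hF.disjoint _ hzF ((hns z hz).2 h)
  -- Each quadrant other than the south-west one contains a corner NW, NE or SE, and these lie on
  -- `northEast`.
  rcases lt_or_gt_of_ne hz'.1 with him | him <;> rcases lt_or_gt_of_ne hz'.2 with hre | hre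
  · right
    intro w hw h1 h2
    refine hF.mem_of_convex P.continuousOn
      ((convex_halfSpace_re_lt (1 / 2)).inter (convex_halfSpace_im_lt (1 / 2))) ?_ hz ⟨hre, him⟩ hzF
      hw ⟨h1, h2⟩
    rintro x ⟨hx, hx1, hx2⟩
    rw [hns x hx, not_or]
    exact ⟨hx2.ne, hx1.ne⟩
  · left
    refine ⟨1, by simp [northEast, unitSquare], hF.mem_of_convex P.continuousOn
      ((convex_halfSpace_re_gt (1 / 2)).inter (convex_halfSpace_im_lt (1 / 2))) ?_ hz ⟨hre, him⟩ hzF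
      (by simp [unitSquare]) (by norm_num)⟩
    rintro x ⟨hx, hx1, hx2⟩
    rw [hns x hx, not_or]
    exact ⟨hx2.ne, hx1.ne'⟩
  · left
    refine ⟨Complex.I, by simp [northEast, unitSquare], hF.mem_of_convex P.continuousOn
      ((convex_halfSpace_re_lt (1 / 2)).inter (convex_halfSpace_im_gt (1 / 2))) ?_ hz ⟨hre, him⟩ hzF
      (by simp [unitSquare]) (by norm_num)⟩
    rintro x ⟨hx, hx1, hx2⟩
    rw [hns x hx, not_or]
    exact ⟨hx2.ne', hx1.ne⟩
  · left
    refine ⟨1 + Complex.I, by simp [northEast, unitSquare], hF.mem_of_convex P.continuousOn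
      ((convex_halfSpace_re_gt (1 / 2)).inter (convex_halfSpace_im_gt (1 / 2))) ?_ hz ⟨hre, him⟩ hzF
      (by simp [unitSquare]) (by norm_num)⟩
    rintro x ⟨hx, hx1, hx2⟩
    rw [hns x hx, not_or]
    exact ⟨hx2.ne', hx1.ne'⟩

/-- If two wires cross in the square, then each region that meets the square contains the north-east
quadrant or a point of the side `southWest`. -/
theorem cross_northEast (P : LocalPicture G op ψ) (hF : G.IsOneSided σ F)
    (hop : ∀ z, (∃ d, op.Strand z d) ↔ z.im = 1 / 2 ∨ z.re = 1 / 2) {z : ℂ} (hz : z ∈ unitSquare)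
    (hzF : ψ z ∈ F) : (∃ w ∈ southWest, ψ w ∈ F) ∨
      ∀ w ∈ unitSquare, 1 / 2 < w.re → 1 / 2 < w.im → ψ w ∈ F := by
  have hns : ∀ w ∈ unitSquare, ψ w ∈ G.support ↔ w.im = 1 / 2 ∨ w.re = 1 / 2 := fun w hw ↦
    (P.mem_support_iff w hw).trans (hop w)
  have hz' := not_or.1 fun h ↦ hF.disjoint _ hzF ((hns z hz).2 h)
  rcases lt_or_gt_of_ne hz'.1 with him | him <;> rcases lt_or_gt_of_ne hz'.2 with hre | hre
  · left
    refine ⟨0, by simp [southWest, unitSquare], hF.mem_of_convex P.continuousOn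
      ((convex_halfSpace_re_lt (1 / 2)).inter (convex_halfSpace_im_lt (1 / 2))) ?_ hz ⟨hre, him⟩ hzF
      (by simp [unitSquare]) (by norm_num)⟩
    rintro x ⟨hx, hx1, hx2⟩
    rw [hns x hx, not_or]
    exact ⟨hx2.ne, hx1.ne⟩
  · left
    refine ⟨1, by simp [southWest, unitSquare], hF.mem_of_convex P.continuousOn
      ((convex_halfSpace_re_gt (1 / 2)).inter (convex_halfSpace_im_lt (1 / 2))) ?_ hz ⟨hre, him⟩ hzF
      (by simp [unitSquare]) (by norm_num)⟩
    rintro x ⟨hx, hx1, hx2⟩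
    rw [hns x hx, not_or]
    exact ⟨hx2.ne, hx1.ne'⟩
  · left
    refine ⟨Complex.I, by simp [southWest, unitSquare], hF.mem_of_convex P.continuousOn
      ((convex_halfSpace_re_lt (1 / 2)).inter (convex_halfSpace_im_gt (1 / 2))) ?_ hz ⟨hre, him⟩ hzF
      (by simp [unitSquare]) (by norm_num)⟩
    rintro x ⟨hx, hx1, hx2⟩
    rw [hns x hx, not_or]
    exact ⟨hx2.ne', hx1.ne⟩
  · right
    intro w hw h1 h2
    refine hF.mem_of_convex P.continuousOn
      ((convex_halfSpace_re_gt (1 / 2)).inter (convex_halfSpace_im_gt (1 / 2))) ?_ hz ⟨hre, him⟩ hzF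
      hw ⟨h1, h2⟩
    rintro x ⟨hx, hx1, hx2⟩
    rw [hns x hx, not_or]
    exact ⟨hx2.ne', hx1.ne'⟩

/-- If one antidiagonal wire passes through the square, then each region that meets the square
contains one of the two sides of this wire. -/
theorem antidiagonal (P : LocalPicture G op ψ) (hF : G.IsOneSided σ F) {r : ℝ}
    (hop : ∀ z, (∃ d, op.Strand z d) ↔ z.re + z.im = r) {z : ℂ} (hz : z ∈ unitSquare)
    (hzF : ψ z ∈ F) : (∀ w ∈ unitSquare, w.re + w.im < r → ψ w ∈ F) ∨
      ∀ w ∈ unitSquare, r < w.re + w.im → ψ w ∈ F := by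
  have hns : ∀ w ∈ unitSquare, ψ w ∈ G.support ↔ w.re + w.im = r := fun w hw ↦
    (P.mem_support_iff w hw).trans (hop w)
  have hlin : IsLinearMap ℝ fun w : ℂ ↦ w.re + w.im :=
    ⟨fun x y ↦ by simp; ring, fun c x ↦ by simp; ring⟩
  rcases lt_or_gt_of_ne (fun h ↦ hF.disjoint _ hzF ((hns z hz).2 h)) with h | h
  · refine Or.inl fun w hw hwr ↦ hF.mem_of_convex P.continuousOn (convex_halfSpace_lt hlin r)
      ?_ hz h hzF hw hwr
    rintro x ⟨hx, hx1⟩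
    rw [hns x hx]
    exact ne_of_lt hx1
  · refine Or.inr fun w hw hwr ↦ hF.mem_of_convex P.continuousOn (convex_halfSpace_gt hlin r)
      ?_ hz h hzF hw hwr
    rintro x ⟨hx, hx1⟩
    rw [hns x hx]
    exact ne_of_gt hx1

/-- A region on the left of its boundary cannot appear under the operations of types A and C,
and a region on the right of its boundary cannot appear under those of types B and C. -/
theorem exists_mem_northEast (P : LocalPicture G op ψ) (hF : G.IsOneSided σ F)
    (h : σ = 1 ∧ op.type ≠ .B ∨ σ = -1 ∧ op.type ≠ .A) {z : ℂ} (hz : z ∈ unitSquare)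
    (hzF : ψ z ∈ F) : ∃ w ∈ northEast, ψ w ∈ F := by
  have hσ : σ ≠ 0 := by rcases h with h | h <;> rw [h.1] <;> norm_num
  cases op with
  | o =>
    refine (P.cross_southWest hF (fun z ↦ by simp [Operation.Strand, exists_or]) hz hzF).resolve_right
      fun hQ ↦ ?_
    -- The quadrant is on the right of the eastward wire and on the left of the northward one, so
    -- both signs are excluded.
    rcases h with ⟨rfl, -⟩ | ⟨rfl, -⟩
    · exact P.not_southWest_horizontal hF hσ hQ (d := 1)
        (fun d ↦ by norm_num [Operation.Strand]) (by simp) (by simp)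
    · exact P.not_southWest_vertical hF hσ hQ (d := Complex.I)
        (fun d ↦ by norm_num [Operation.Strand]) (by simp) (by simp)
  | h =>
    refine (P.cross_southWest hF (fun z ↦ by simp [Operation.Strand, exists_or]) hz hzF).resolve_right
      fun hQ ↦ ?_
    rcases h with ⟨rfl, h⟩ | ⟨rfl, -⟩
    · exact h rfl
    · exact P.not_southWest_horizontal hF hσ hQ (d := -1)
        (fun d ↦ by norm_num [Operation.Strand]) (by simp) (by simp)
  | v =>
    refine (P.cross_southWest hF (fun z ↦ by simp [Operation.Strand, exists_or]) hz hzF).resolve_right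
      fun hQ ↦ ?_
    -- Here the quadrant is on the right of both wires, so only `σ = 1` is excluded by geometry; the
    -- type excludes `σ = -1`.
    rcases h with ⟨rfl, -⟩ | ⟨rfl, h⟩
    · exact P.not_southWest_horizontal hF hσ hQ (d := 1)
        (fun d ↦ by norm_num [Operation.Strand]) (by simp) (by simp)
    · exact h rfl
  | t =>
    refine (P.cross_southWest hF (fun z ↦ by simp [Operation.Strand, exists_or]) hz hzF).resolve_right
      fun hQ ↦ ?_
    rcases h with ⟨rfl, -⟩ | ⟨rfl, -⟩
    · exact P.not_southWest_vertical hF hσ hQ (d := -Complex.I)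
        (fun d ↦ by norm_num [Operation.Strand]) (by simp) (by simp)
    · exact P.not_southWest_horizontal hF hσ hQ (d := -1)
        (fun d ↦ by norm_num [Operation.Strand]) (by simp) (by simp)
  | I =>
    -- Both pieces contain a corner on `northEast`, so no direction is needed.
    rcases P.antidiagonal hF (r := 3 / 2) (fun z ↦ by simp [Operation.Strand]) hz hzF with hQ | hQ
    · exact ⟨1, by simp [northEast, unitSquare], hQ 1 (by simp [unitSquare]) (by norm_num)⟩
    · exact ⟨1 + Complex.I, by simp [northEast, unitSquare],
        hQ _ (by simp [unitSquare]) (by norm_num)⟩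
  | I' =>
    rcases P.antidiagonal hF (r := 3 / 2) (fun z ↦ by simp [Operation.Strand]) hz hzF with hQ | hQ
    · exact ⟨1, by simp [northEast, unitSquare], hQ 1 (by simp [unitSquare]) (by norm_num)⟩
    · exact ⟨1 + Complex.I, by simp [northEast, unitSquare],
        hQ _ (by simp [unitSquare]) (by norm_num)⟩
  | iI =>
    rcases P.antidiagonal hF (r := 1 / 2) (fun z ↦ by simp [Operation.Strand]) hz hzF with hQ | hQ
    · rcases h with ⟨rfl, -⟩ | ⟨rfl, h⟩
      · exact (P.not_southWest_diagonal hF hσ hQ (d := 1 - Complex.I)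
          (fun d ↦ by norm_num [Operation.Strand]) (by simp) (by simp)).elim
      · exact (h rfl).elim
    · exact ⟨1, by simp [northEast, unitSquare], hQ 1 (by simp [unitSquare]) (by norm_num)⟩
  | iI' =>
    rcases P.antidiagonal hF (r := 1 / 2) (fun z ↦ by simp [Operation.Strand]) hz hzF with hQ | hQ
    · rcases h with ⟨rfl, h⟩ | ⟨rfl, -⟩
      · exact (h rfl).elim
      · exact (P.not_southWest_diagonal hF hσ hQ (d := -1 + Complex.I)
          (fun d ↦ by norm_num [Operation.Strand]) (by simp) (by simp)).elim
    · exact ⟨1, by simp [northEast, unitSquare], hQ 1 (by simp [unitSquare]) (by norm_num)⟩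

/-- A region on the left of its boundary cannot disappear under the operations of types B and C,
and a region on the right of its boundary cannot disappear under those of types A and C. -/
theorem exists_mem_southWest (P : LocalPicture G op ψ) (hF : G.IsOneSided σ F)
    (h : σ = 1 ∧ op.type ≠ .A ∨ σ = -1 ∧ op.type ≠ .B) {z : ℂ} (hz : z ∈ unitSquare)
    (hzF : ψ z ∈ F) : ∃ w ∈ southWest, ψ w ∈ F := by
  have hσ : σ ≠ 0 := by rcases h with h | h <;> rw [h.1] <;> norm_num
  cases op with
  | o =>
    refine (P.cross_northEast hF (fun z ↦ by simp [Operation.Strand, exists_or]) hz hzF).resolve_right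
      fun hQ ↦ ?_
    rcases h with ⟨rfl, -⟩ | ⟨rfl, -⟩
    · exact P.not_northEast_vertical hF hσ hQ (d := Complex.I)
        (fun d ↦ by norm_num [Operation.Strand]) (by simp) (by simp)
    · exact P.not_northEast_horizontal hF hσ hQ (d := 1)
        (fun d ↦ by norm_num [Operation.Strand]) (by simp) (by simp)
  | h =>
    refine (P.cross_northEast hF (fun z ↦ by simp [Operation.Strand, exists_or]) hz hzF).resolve_right
      fun hQ ↦ ?_
    rcases h with ⟨rfl, -⟩ | ⟨rfl, h⟩
    · exact P.not_northEast_horizontal hF hσ hQ (d := -1)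
        (fun d ↦ by norm_num [Operation.Strand]) (by simp) (by simp)
    · exact h rfl
  | v =>
    refine (P.cross_northEast hF (fun z ↦ by simp [Operation.Strand, exists_or]) hz hzF).resolve_right
      fun hQ ↦ ?_
    -- The north-east quadrant is on the left of both wires, so the roles of the signs are
    -- exchanged.
    rcases h with ⟨rfl, h⟩ | ⟨rfl, -⟩
    · exact h rfl
    · exact P.not_northEast_horizontal hF hσ hQ (d := 1)
        (fun d ↦ by norm_num [Operation.Strand]) (by simp) (by simp)
  | t =>
    refine (P.cross_northEast hF (fun z ↦ by simp [Operation.Strand, exists_or]) hz hzF).resolve_right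
      fun hQ ↦ ?_
    rcases h with ⟨rfl, -⟩ | ⟨rfl, -⟩
    · exact P.not_northEast_horizontal hF hσ hQ (d := -1)
        (fun d ↦ by norm_num [Operation.Strand]) (by simp) (by simp)
    · exact P.not_northEast_vertical hF hσ hQ (d := -Complex.I)
        (fun d ↦ by norm_num [Operation.Strand]) (by simp) (by simp)
  | I =>
    rcases P.antidiagonal hF (r := 3 / 2) (fun z ↦ by simp [Operation.Strand]) hz hzF with hQ | hQ
    · exact ⟨1, by simp [southWest, unitSquare], hQ 1 (by simp [unitSquare]) (by norm_num)⟩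
    · rcases h with ⟨rfl, h⟩ | ⟨rfl, -⟩
      · exact (h rfl).elim
      · exact (P.not_northEast_diagonal hF hσ hQ (d := 1 - Complex.I)
          (fun d ↦ by norm_num [Operation.Strand]) (by simp) (by simp)).elim
  | I' =>
    rcases P.antidiagonal hF (r := 3 / 2) (fun z ↦ by simp [Operation.Strand]) hz hzF with hQ | hQ
    · exact ⟨1, by simp [southWest, unitSquare], hQ 1 (by simp [unitSquare]) (by norm_num)⟩
    · rcases h with ⟨rfl, -⟩ | ⟨rfl, h⟩
      · exact (P.not_northEast_diagonal hF hσ hQ (d := -1 + Complex.I)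
          (fun d ↦ by norm_num [Operation.Strand]) (by simp) (by simp)).elim
      · exact (h rfl).elim
  | iI =>
    rcases P.antidiagonal hF (r := 1 / 2) (fun z ↦ by simp [Operation.Strand]) hz hzF with hQ | hQ
    · exact ⟨0, by simp [southWest, unitSquare], hQ 0 (by simp [unitSquare]) (by norm_num)⟩
    · exact ⟨1, by simp [southWest, unitSquare], hQ 1 (by simp [unitSquare]) (by norm_num)⟩
  | iI' =>
    rcases P.antidiagonal hF (r := 1 / 2) (fun z ↦ by simp [Operation.Strand]) hz hzF with hQ | hQ
    · exact ⟨0, by simp [southWest, unitSquare], hQ 0 (by simp [unitSquare]) (by norm_num)⟩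
    · exact ⟨1, by simp [southWest, unitSquare], hQ 1 (by simp [unitSquare]) (by norm_num)⟩

end LocalPicture

/-- Each region that meets the square of an isotopy contains one of its corners NW and SE. -/
theorem WiringDiagram.IsOneSided.corner_mem_of_isotopy {G : WiringDiagram} {σ : ℝ} {F : Set ℂ}
    (hF : G.IsOneSided σ F) {ψ : ℂ → ℂ} (hψ : ContinuousOn ψ unitSquare)
    (h : (∀ z ∈ unitSquare, ψ z ∉ G.support) ∨
      ∀ z ∈ unitSquare, ψ z ∈ G.support ↔ z.re = z.im) {z : ℂ} (hz : z ∈ unitSquare)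
    (hzF : ψ z ∈ F) : ψ Complex.I ∈ F ∨ ψ 1 ∈ F := by
  rcases h with h | h
  · exact Or.inr (hF.mem_of_convex hψ convex_univ (fun x hx ↦ h x hx.1) hz (mem_univ _) hzF
      (by simp [unitSquare]) (mem_univ _))
  · have hlin : IsLinearMap ℝ fun w : ℂ ↦ w.re - w.im :=
      ⟨fun x y ↦ by simp; ring, fun c x ↦ by simp; ring⟩
    rcases lt_or_gt_of_ne (fun he ↦ hF.disjoint _ hzF ((h z hz).2 he)) with hlt | hgt
    · refine Or.inl (hF.mem_of_convex hψ (convex_halfSpace_lt hlin 0) ?_ hz (sub_neg.2 hlt) hzF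
        (by simp [unitSquare]) (by norm_num))
      rintro x ⟨hx, hx1⟩
      rw [h x hx]
      exact ne_of_lt (sub_neg.1 hx1)
    · refine Or.inr (hF.mem_of_convex hψ (convex_halfSpace_gt hlin 0) ?_ hz (sub_pos.2 hgt) hzF
        (by simp [unitSquare]) (by norm_num))
      rintro x ⟨hx, hx1⟩
      rw [h x hx]
      exact ne_of_gt (sub_pos.1 hx1)

namespace FundamentalDomain

variable {G : WiringDiagram}

/-! ### Coordinates of the fundamental domain -/

/-- The inverse of the affine parametrization of the fundamental domain. -/
noncomputable def coord (D : FundamentalDomain G) (w : ℂ) : ℂ :=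
  ⟨(w - D.corner).re * D.north.im - (w - D.corner).im * D.north.re,
    D.east.re * (w - D.corner).im - D.east.im * (w - D.corner).re⟩

theorem det_eq_one_real (D : FundamentalDomain G) :
    (D.east : ℂ).re * (D.north : ℂ).im - (D.east : ℂ).im * (D.north : ℂ).re = 1 := by
  simp only [← GaussianInt.intCast_re, ← GaussianInt.intCast_im]
  exact_mod_cast D.det_eq_one

theorem coord_param (D : FundamentalDomain G) (z : ℂ) : D.coord (D.param z) = z := by
  have h := D.det_eq_one_real
  apply Complex.ext
  · simp [coord, param]
    linear_combination z.re * h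
  · simp [coord, param]
    linear_combination z.im * h

theorem param_coord (D : FundamentalDomain G) (w : ℂ) : D.param (D.coord w) = w := by
  have h := D.det_eq_one_real
  apply Complex.ext
  · simp [coord, param]
    linear_combination (w.re - D.corner.re) * h
  · simp [coord, param]
    linear_combination (w.im - D.corner.im) * h

theorem continuous_coord (D : FundamentalDomain G) : Continuous D.coord := by
  have h1 := Complex.continuous_re
  have h2 := Complex.continuous_im
  have : D.coord = fun w ↦ (((w - D.corner).re * D.north.im - (w - D.corner).im * D.north.re : ℝ) : ℂ)
      + ((D.east.re * (w - D.corner).im - D.east.im * (w - D.corner).re : ℝ) : ℂ) * Complex.I := by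
    ext w; simp [coord, Complex.mk_eq_add_mul_I]
  rw [this]
  fun_prop

theorem coord_sub_lattice (D : FundamentalDomain G) (w : ℂ) (a b : ℤ) :
    D.coord (w - ((a * D.east + b * D.north : GaussianInt) : ℂ)) = D.coord w - (a + b * Complex.I) := by
  have h := D.det_eq_one_real
  apply Complex.ext
  · simp [coord]
    linear_combination -(a : ℝ) * h
  · simp [coord]
    linear_combination -(b : ℝ) * h

/-! ### Regions that meet the sides of the fundamental domain -/

/-- A property of lattice vectors `l`, which implies that `F` meets the `l`-translate of the
fundamental domain, cannot propagate indefinitely in one direction if `F` is bounded. -/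
theorem not_of_propagates (D : FundamentalDomain G) {F : Set ℂ} (hF : Bornology.IsBounded F)
    {P : GaussianInt → Prop} (hP : ∀ l, P l → ∃ z ∈ unitSquare, D.param z + (l : ℂ) ∈ F)
    {s : ℤ} (hs : s ≠ 0) (hstep : ∀ l, P l → P (l + s * D.north) ∨ P (l + s * D.east))
    (l : GaussianInt) : ¬ P l := by
  intro hl
  -- `φ l` is the sum of the coordinates of `l` in the basis `east`, `north`, so either step changes
  -- it by exactly `s`.
  let φ : GaussianInt → ℤ := fun l ↦
    l.re * D.north.im - l.im * D.north.re + (D.east.re * l.im - D.east.im * l.re)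
  have hdet := D.det_eq_one
  have hiter : ∀ k : ℕ, ∃ l', P l' ∧ φ l' = φ l + s * k := by
    intro k
    induction k with
    | zero => exact ⟨l, hl, by simp⟩
    | succ k ih =>
      obtain ⟨l', hl', hφ⟩ := ih
      rcases hstep l' hl' with h | h
      · refine ⟨_, h, ?_⟩
        simp only [φ] at hφ ⊢
        simp
        linear_combination hφ + s * hdet
      · refine ⟨_, h, ?_⟩
        simp only [φ] at hφ ⊢
        simp
        linear_combination hφ + s * hdet
  obtain ⟨C, hC⟩ := hF.isCompact_closure.exists_bound_of_continuousOn
    (f := fun w ↦ (D.coord w).re + (D.coord w).im)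
    ((Complex.continuous_re.comp D.continuous_coord).add
      (Complex.continuous_im.comp D.continuous_coord)).continuousOn
  -- A point of the unit square contributes at most `2` to the coordinate sum.
  have hbound : ∀ l', P l' → |(φ l' : ℝ)| ≤ C + 2 := by
    intro l' hl'
    obtain ⟨z, ⟨z1, z2, z3, z4⟩, hz⟩ := hP l' hl'
    have h1 := hC _ (subset_closure hz)
    have h2 : (D.coord (D.param z + (l' : ℂ))).re + (D.coord (D.param z + (l' : ℂ))).im
        = z.re + z.im + φ l' := by
      have := D.det_eq_one_real
      simp [coord, param, φ]
      linear_combination (z.re + z.im) * this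
    rw [Real.norm_eq_abs, h2, abs_le] at h1
    rw [abs_le]
    constructor <;> linarith [h1.1, h1.2]
  obtain ⟨k, hk⟩ := exists_nat_gt (C + 2 + |(φ l : ℝ)|)
  obtain ⟨l', hl', hφ⟩ := hiter k
  have h1 := hbound l' hl'
  have h2 : (φ l' : ℝ) = φ l + s * k := by exact_mod_cast hφ
  have h3 : (1 : ℝ) ≤ |(s : ℝ)| := by exact_mod_cast Int.one_le_abs hs
  have h4 : |(s * k : ℝ)| ≤ |(φ l' : ℝ)| + |(φ l : ℝ)| := by
    have : (s * k : ℝ) = φ l' - φ l := by rw [h2]; ring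
    rw [this]
    exact abs_sub _ _
  rw [abs_mul, Nat.abs_cast] at h4
  have h5 : (k : ℝ) ≤ |(s : ℝ)| * k := le_mul_of_one_le_left (Nat.cast_nonneg k) h3
  linarith

/-- The east and north sides of a translate of the domain are the west and south sides of its
neighbours. -/
theorem northEast_translate (D : FundamentalDomain G) {F : Set ℂ} {l : GaussianInt}
    (h : ∃ z ∈ northEast, D.param z + (l : ℂ) ∈ F) :
    (∃ z ∈ southWest, D.param z + ((l + D.north : GaussianInt) : ℂ) ∈ F) ∨
      ∃ z ∈ southWest, D.param z + ((l + D.east : GaussianInt) : ℂ) ∈ F := by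
  obtain ⟨z, ⟨⟨z1, z2, z3, z4⟩, hz | hz⟩, hzF⟩ := h
  · refine Or.inr ⟨z - 1, by simp [southWest, unitSquare, z3, z4, hz], ?_⟩
    convert! hzF using 1
    simp [param]; ring
  · refine Or.inl ⟨z - Complex.I, by simp [southWest, unitSquare, z1, z2, hz], ?_⟩
    convert! hzF using 1
    simp [param]; ring

theorem southWest_translate (D : FundamentalDomain G) {F : Set ℂ} {l : GaussianInt}
    (h : ∃ z ∈ southWest, D.param z + (l : ℂ) ∈ F) :
    (∃ z ∈ northEast, D.param z + ((l - D.north : GaussianInt) : ℂ) ∈ F) ∨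
      ∃ z ∈ northEast, D.param z + ((l - D.east : GaussianInt) : ℂ) ∈ F := by
  obtain ⟨z, ⟨⟨z1, z2, z3, z4⟩, hz | hz⟩, hzF⟩ := h
  · refine Or.inr ⟨z + 1, by simp [northEast, unitSquare, z3, z4, hz], ?_⟩
    convert! hzF using 1
    simp [param]; ring
  · refine Or.inl ⟨z + Complex.I, by simp [northEast, unitSquare, z1, z2, hz], ?_⟩
    convert! hzF using 1
    simp [param]; ring

/-! ### The moving arrow -/

/-- The vector from `p` to `w` in the coordinates of the fundamental domain, up to a
constant factor. -/
noncomputable def displacement (D : FundamentalDomain G) (p w : ℂ) : ℂ :=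
  (D.coord w - D.coord p) * (1 - Complex.I)

theorem displacement_ne_zero (D : FundamentalDomain G) {p w : ℂ} (h : w ≠ p) :
    D.displacement p w ≠ 0 := by
  refine mul_ne_zero (sub_ne_zero.2 fun h' ↦ h ?_) fun h' ↦ ?_
  · rw [← D.param_coord w, h', D.param_coord]
  · simpa using congrArg Complex.re h'

variable {D : FundamentalDomain G} {ψ : ℂ → ℂ} {g g' : ℝ → ℂ} {F : Set ℂ}

/-- If the arrow moves across a square that does not contain `p`, then it turns around `p` by the
same angle before and after the move. -/
theorem Pushes.hasLogAlong (h : D.Pushes ψ g g') (hg : D.IsArrow g) (hg' : D.IsArrow g')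
    {p : ℂ} (hp : ∀ z ∈ unitSquare, ψ z ≠ p) {w₀ w₁ : ℂ}
    (hlog : HasLogAlong (fun s ↦ D.displacement p (g s)) w₀ w₁) :
    HasLogAlong (fun s ↦ D.displacement p (g' s)) w₀ w₁ := by
  obtain ⟨hψ, hinj, -, a, b, ha, hab, hb, heq, -, -, him, him'⟩ := h
  obtain ⟨M, hM, hexp⟩ := exists_log_on_image_unitSquare hψ hinj (k := D.displacement p)
    ((D.continuous_coord.sub continuous_const).mul continuous_const) (by
      rintro _ ⟨z, hz, rfl⟩
      exact D.displacement_ne_zero (hp z hz))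
  refine HasLogAlong.replace hM hexp hg.continuousOn hg'.continuousOn ha hab hb heq ?_ ?_ hlog
  · intro s hs
    have : g s ∈ ψ '' northEast := him ▸ mem_image_of_mem g hs
    exact image_mono (fun _ h ↦ h.1) this
  · intro s hs
    have : g' s ∈ ψ '' southWest := him' ▸ mem_image_of_mem g' hs
    exact image_mono (fun _ h ↦ h.1) this

theorem Pushes.exists_mem_left (h : D.Pushes ψ g g') (hw : ∃ w ∈ northEast, ψ w ∈ F) :
    ∃ s ∈ Icc (0 : ℝ) 1, g s ∈ F := by
  obtain ⟨-, -, -, a, b, ha, hab, hb, heq, -, -, him, him'⟩ := h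
  obtain ⟨w, hw, hwF⟩ := hw
  obtain ⟨s, hs, hsw⟩ : ψ w ∈ g '' Icc a b := him ▸ mem_image_of_mem ψ hw
  exact ⟨s, Icc_subset_Icc ha hb hs, hsw ▸ hwF⟩

theorem Pushes.exists_mem_right (h : D.Pushes ψ g g') (hw : ∃ w ∈ southWest, ψ w ∈ F) :
    ∃ s ∈ Icc (0 : ℝ) 1, g' s ∈ F := by
  obtain ⟨-, -, -, a, b, ha, hab, hb, heq, -, -, him, him'⟩ := h
  obtain ⟨w, hw, hwF⟩ := hw
  obtain ⟨s, hs, hsw⟩ : ψ w ∈ g' '' Icc a b := him' ▸ mem_image_of_mem ψ hw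
  exact ⟨s, Icc_subset_Icc ha hb hs, hsw ▸ hwF⟩

/-- If the square met `F`, so would its side `northEast`, which is a piece of `g`. Thus the whole
square misses `F`, and `g'` leaves `g` only inside it. -/
theorem Pushes.avoids_of_left (h : D.Pushes ψ g g')
    (hsq : ∀ z ∈ unitSquare, ψ z ∈ F → ∃ w ∈ northEast, ψ w ∈ F)
    (hg : ∀ s ∈ Icc (0 : ℝ) 1, g s ∉ F) :
    (∀ s ∈ Icc (0 : ℝ) 1, g' s ∉ F) ∧ ∀ z ∈ unitSquare, ψ z ∉ F := by
  have hz : ∀ z ∈ unitSquare, ψ z ∉ F := fun z hz hzF ↦ by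
    obtain ⟨s, hs, hsF⟩ := h.exists_mem_left (hsq z hz hzF)
    exact hg s hs hsF
  refine ⟨fun s hs hsF ↦ ?_, hz⟩
  obtain ⟨-, -, -, a, b, ha, hab, hb, heq, -, -, him, him'⟩ := h
  by_cases hsab : s ∈ Icc a b
  · obtain ⟨w, hw, hws⟩ : g' s ∈ ψ '' southWest := him' ▸ mem_image_of_mem g' hsab
    exact hz w hw.1 (hws ▸ hsF)
  · exact hg s hs (heq s hs (fun h ↦ hsab (Ioo_subset_Icc_self h)) ▸ hsF)

theorem Pushes.avoids_of_right (h : D.Pushes ψ g g')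
    (hsq : ∀ z ∈ unitSquare, ψ z ∈ F → ∃ w ∈ southWest, ψ w ∈ F)
    (hg' : ∀ s ∈ Icc (0 : ℝ) 1, g' s ∉ F) :
    (∀ s ∈ Icc (0 : ℝ) 1, g s ∉ F) ∧ ∀ z ∈ unitSquare, ψ z ∉ F := by
  have hz : ∀ z ∈ unitSquare, ψ z ∉ F := fun z hz hzF ↦ by
    obtain ⟨s, hs, hsF⟩ := h.exists_mem_right (hsq z hz hzF)
    exact hg' s hs hsF
  refine ⟨fun s hs hsF ↦ ?_, hz⟩
  obtain ⟨-, -, -, a, b, ha, hab, hb, heq, -, -, him, him'⟩ := h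
  by_cases hsab : s ∈ Icc a b
  · obtain ⟨w, hw, hws⟩ : g s ∈ ψ '' northEast := him ▸ mem_image_of_mem g hsab
    exact hz w hw.1 (hws ▸ hsF)
  · exact hg' s hs ((heq s hs (fun h ↦ hsab (Ioo_subset_Icc_self h))).symm ▸ hsF)

theorem IsOperation.exists_localPicture {op : Operation} (h : D.IsOperation op g g') :
    ∃ ψ, D.Pushes ψ g g' ∧ LocalPicture G op ψ := by
  obtain ⟨ψ, hψ, h1, h2, h3, h4⟩ := h
  exact ⟨ψ, hψ, hψ.1, h1, h2, h3, h4⟩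

theorem Transforms.isArrow {ops : List Operation} (h : D.Transforms g ops g') : D.IsArrow g' := by
  cases h <;> assumption

/-- If the region `F` cannot appear, then an arrow that initially avoids `F` does not
move across `F`. -/
theorem Transforms.avoids_of_left {σ : ℝ} (hF : G.IsOneSided σ F) {ops : List Operation}
    (h : D.Transforms g ops g')
    (hops : ∀ op ∈ ops, σ = 1 ∧ op.type ≠ .B ∨ σ = -1 ∧ op.type ≠ .A)
    (hg : ∀ s ∈ Icc (0 : ℝ) 1, g s ∉ F) :
    (∀ s ∈ Icc (0 : ℝ) 1, g' s ∉ F) ∧ ∀ p ∈ F, ∀ w₀ w₁,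
      HasLogAlong (fun s ↦ D.displacement p (g s)) w₀ w₁ →
        HasLogAlong (fun s ↦ D.displacement p (g' s)) w₀ w₁ := by
  induction h with
  | refl _ => exact ⟨hg, fun _ _ _ _ h ↦ h⟩
  | isotopy hT hA hI ih =>
    obtain ⟨h1, h2⟩ := ih hops
    obtain ⟨ψ, hψ, hsupp⟩ := hI
    -- The corners NW and SE lie on both sides of the square, so isotopies can neither create nor
    -- remove an intersection with `F`.
    have h := hψ.avoids_of_left (F := F) (fun z hz hzF ↦
      (hF.corner_mem_of_isotopy hψ.1 hsupp hz hzF).elim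
        (fun h ↦ ⟨_, by simp [northEast, unitSquare], h⟩)
        (fun h ↦ ⟨_, by simp [northEast, unitSquare], h⟩)) h1
    exact ⟨h.1, fun p hp w₀ w₁ hlog ↦ hψ.hasLogAlong hT.isArrow hA
      (fun z hz hzp ↦ h.2 z hz (hzp ▸ hp)) (h2 p hp w₀ w₁ hlog)⟩
  | operation op hT hA hO ih =>
    obtain ⟨h1, h2⟩ := ih fun op h ↦ hops op (List.mem_append_left _ h)
    obtain ⟨ψ, hψ, P⟩ := hO.exists_localPicture
    have h := hψ.avoids_of_left (F := F) (fun z hz hzF ↦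
      P.exists_mem_northEast hF (hops op (by simp)) hz hzF) h1
    exact ⟨h.1, fun p hp w₀ w₁ hlog ↦ hψ.hasLogAlong hT.isArrow hA
      (fun z hz hzp ↦ h.2 z hz (hzp ▸ hp)) (h2 p hp w₀ w₁ hlog)⟩

/-- If the region `F` cannot disappear, then an arrow that finally avoids `F` does not
move across `F`. -/
theorem Transforms.avoids_of_right {σ : ℝ} (hF : G.IsOneSided σ F) {ops : List Operation}
    (h : D.Transforms g ops g')
    (hops : ∀ op ∈ ops, σ = 1 ∧ op.type ≠ .A ∨ σ = -1 ∧ op.type ≠ .B)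
    (hg' : ∀ s ∈ Icc (0 : ℝ) 1, g' s ∉ F) :
    (∀ s ∈ Icc (0 : ℝ) 1, g s ∉ F) ∧ ∀ p ∈ F, ∀ w₀ w₁,
      HasLogAlong (fun s ↦ D.displacement p (g s)) w₀ w₁ →
        HasLogAlong (fun s ↦ D.displacement p (g' s)) w₀ w₁ := by
  -- Avoidance is known for the last arrow, so each case first passes it back to the preceding arrow
  -- and only then uses the induction hypothesis.
  induction h with
  | refl _ => exact ⟨hg', fun _ _ _ _ h ↦ h⟩
  | isotopy hT hA hI ih =>
    obtain ⟨ψ, hψ, hsupp⟩ := hI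
    have h := hψ.avoids_of_right (F := F) (fun z hz hzF ↦
      (hF.corner_mem_of_isotopy hψ.1 hsupp hz hzF).elim
        (fun h ↦ ⟨_, by simp [southWest, unitSquare], h⟩)
        (fun h ↦ ⟨_, by simp [southWest, unitSquare], h⟩)) hg'
    obtain ⟨h1, h2⟩ := ih hops h.1
    exact ⟨h1, fun p hp w₀ w₁ hlog ↦ hψ.hasLogAlong hT.isArrow hA
      (fun z hz hzp ↦ h.2 z hz (hzp ▸ hp)) (h2 p hp w₀ w₁ hlog)⟩
  | operation op hT hA hO ih =>
    obtain ⟨ψ, hψ, P⟩ := hO.exists_localPicture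
    have h := hψ.avoids_of_right (F := F) (fun z hz hzF ↦
      P.exists_mem_southWest hF (hops op (by simp)) hz hzF) hg'
    obtain ⟨h1, h2⟩ := ih (fun op h ↦ hops op (List.mem_append_left _ h)) h.1
    exact ⟨h1, fun p hp w₀ w₁ hlog ↦ hψ.hasLogAlong hT.isArrow hA
      (fun z hz hzp ↦ h.2 z hz (hzp ▸ hp)) (h2 p hp w₀ w₁ hlog)⟩

/-! ### The contradiction for bounded one-sided regions -/

/-- The arrow, on its way from the north-east to the south-west side of the fundamental domain, has
to move across each region, possibly after a translation of this region. -/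
theorem exists_moves_across (hg : D.IsNEArrow g) (hg' : D.IsSWArrow g') (hne : F.Nonempty) :
    ∃ l : GaussianInt, ¬ ((∀ s ∈ Icc (0 : ℝ) 1, g s + (l : ℂ) ∉ F) ∧
      (∀ s ∈ Icc (0 : ℝ) 1, g' s + (l : ℂ) ∉ F) ∧ ∀ p, p + (l : ℂ) ∈ F → ∀ w₀ w₁,
        HasLogAlong (fun s ↦ D.displacement p (g s)) w₀ w₁ →
          HasLogAlong (fun s ↦ D.displacement p (g' s)) w₀ w₁) := by
  obtain ⟨p₀, hp₀⟩ := hne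
  -- The integer parts of the coordinates give the translation that moves `p₀` into the half-open
  -- domain.
  set a := ⌊(D.coord p₀).re⌋ with ha
  set b := ⌊(D.coord p₀).im⌋ with hb
  set l : GaussianInt := a * D.east + b * D.north with hl
  refine ⟨l, fun ⟨h1, h2, h3⟩ ↦ ?_⟩
  set p := p₀ - (l : ℂ) with hp
  have hpF : p + (l : ℂ) ∈ F := by simpa [hp] using hp₀
  have hq : D.coord p = D.coord p₀ - (a + b * Complex.I) := D.coord_sub_lattice p₀ a b
  have hre : (D.coord p).re = Int.fract (D.coord p₀).re := by
    rw [hq, Int.fract]; simp [ha]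
  have him : (D.coord p).im = Int.fract (D.coord p₀).im := by
    rw [hq, Int.fract]; simp [hb]
  have hsq : D.coord p ∈ unitSquare :=
    ⟨hre ▸ Int.fract_nonneg _, hre ▸ (Int.fract_lt_one _).le, him ▸ Int.fract_nonneg _,
      him ▸ (Int.fract_lt_one _).le⟩
  -- A vanishing coordinate would put `p` on the SW arrow, which avoids the region; hence `p` is
  -- interior.
  have hns : D.coord p ∉ southWest := by
    intro h
    obtain ⟨s, hs, hsp⟩ : p ∈ g' '' Icc 0 1 := by
      rw [hg'.2]
      exact ⟨_, h, D.param_coord p⟩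
    exact h2 s hs (hsp ▸ hpF)
  have hopen : D.coord p ∈ openUnitSquare :=
    ⟨lt_of_le_of_ne hsq.1 fun h ↦ hns ⟨hsq, Or.inl h.symm⟩, hre ▸ Int.fract_lt_one _,
      lt_of_le_of_ne hsq.2.2.1 fun h ↦ hns ⟨hsq, Or.inr h.symm⟩, him ▸ Int.fract_lt_one _⟩
  obtain ⟨w₀, w₁, hlog, hlog'⟩ := not_hasLogAlong_both_sides hopen
    (g := fun s ↦ D.coord (g s)) (g' := fun s ↦ D.coord (g' s))
    (D.continuous_coord.comp_continuousOn hg.1.continuousOn)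
    (D.continuous_coord.comp_continuousOn hg'.1.continuousOn)
    (fun s hs ↦ by
      obtain ⟨z, hz, hzs⟩ : g s ∈ D.param '' northEast := hg.2 ▸ mem_image_of_mem g hs
      rwa [← hzs, D.coord_param])
    (fun s hs ↦ by
      obtain ⟨z, hz, hzs⟩ : g' s ∈ D.param '' southWest := hg'.2 ▸ mem_image_of_mem g' hs
      rwa [← hzs, D.coord_param])
    (by rw [hg.1.start, D.coord_param]) (by rw [hg.1.finish, D.coord_param])
    (by rw [hg'.1.start, D.coord_param]) (by rw [hg'.1.finish, D.coord_param])
  exact hlog' (h3 p hpF w₀ w₁ hlog)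

/-- A bounded one-sided region obstructs transformations from the NE arrow to the SW arrow by which
it cannot appear. -/
theorem Transforms.false_of_not_appear {σ : ℝ} (hF : G.IsOneSided σ F) (hne : F.Nonempty)
    (hbdd : Bornology.IsBounded F) {ops : List Operation} (h : D.Transforms g ops g')
    (hg : D.IsNEArrow g) (hg' : D.IsSWArrow g')
    (hops : ∀ op ∈ ops, σ = 1 ∧ op.type ≠ .B ∨ σ = -1 ∧ op.type ≠ .A) : False := by
  have key := fun l : GaussianInt ↦ h.avoids_of_left (hF.translate l) hops
  -- If the final arrow met the translate and the initial one did not, the region would have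
  -- appeared.
  have hmono : ∀ l : GaussianInt, (∃ z ∈ southWest, D.param z + (l : ℂ) ∈ F) →
      ∃ z ∈ northEast, D.param z + (l : ℂ) ∈ F := by
    rintro l ⟨z, hz, hzF⟩
    by_contra! hcon
    obtain ⟨s, hs, hsz⟩ : D.param z ∈ g' '' Icc 0 1 := hg'.2 ▸ mem_image_of_mem _ hz
    refine (key l fun s hs hsF ↦ ?_).1 s hs (by rwa [mem_preimage, hsz])
    obtain ⟨w, hw, hws⟩ : g s ∈ D.param '' northEast := hg.2 ▸ mem_image_of_mem g hs
    exact hcon w hw (by rwa [hws])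
  have hNE := D.not_of_propagates hbdd
    (P := fun l ↦ ∃ z ∈ northEast, D.param z + (l : ℂ) ∈ F)
    (fun l ⟨z, hz, hzF⟩ ↦ ⟨z, hz.1, hzF⟩) one_ne_zero
    (fun l hl ↦ by
      rw [Int.cast_one, one_mul, one_mul]
      exact (D.northEast_translate hl).imp (hmono _) (hmono _))
  obtain ⟨l, hl⟩ := exists_moves_across hg hg' hne
  have hgl : ∀ s ∈ Icc (0 : ℝ) 1, g s + (l : ℂ) ∉ F := fun s hs hsF ↦ by
    obtain ⟨w, hw, hws⟩ : g s ∈ D.param '' northEast := hg.2 ▸ mem_image_of_mem g hs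
    exact hNE l ⟨w, hw, by rwa [hws]⟩
  exact hl ⟨hgl, key l hgl⟩

/-- A bounded one-sided region obstructs transformations from the NE arrow to the SW arrow by which
it cannot disappear. -/
theorem Transforms.false_of_not_disappear {σ : ℝ} (hF : G.IsOneSided σ F) (hne : F.Nonempty)
    (hbdd : Bornology.IsBounded F) {ops : List Operation} (h : D.Transforms g ops g')
    (hg : D.IsNEArrow g) (hg' : D.IsSWArrow g')
    (hops : ∀ op ∈ ops, σ = 1 ∧ op.type ≠ .A ∨ σ = -1 ∧ op.type ≠ .B) : False := by
  have key := fun l : GaussianInt ↦ h.avoids_of_right (hF.translate l) hops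
  have hmono : ∀ l : GaussianInt, (∃ z ∈ northEast, D.param z + (l : ℂ) ∈ F) →
      ∃ z ∈ southWest, D.param z + (l : ℂ) ∈ F := by
    rintro l ⟨z, hz, hzF⟩
    by_contra! hcon
    obtain ⟨s, hs, hsz⟩ : D.param z ∈ g '' Icc 0 1 := hg.2 ▸ mem_image_of_mem _ hz
    refine (key l fun s hs hsF ↦ ?_).1 s hs (by rwa [mem_preimage, hsz])
    obtain ⟨w, hw, hws⟩ : g' s ∈ D.param '' southWest := hg'.2 ▸ mem_image_of_mem g' hs
    exact hcon w hw (by rwa [hws])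
  -- Reading the moves backwards reverses the drift, hence `s = -1`.
  have hSW := D.not_of_propagates hbdd
    (P := fun l ↦ ∃ z ∈ southWest, D.param z + (l : ℂ) ∈ F)
    (fun l ⟨z, hz, hzF⟩ ↦ ⟨z, hz.1, hzF⟩) (s := -1) (by norm_num)
    (fun l hl ↦ by
      simp only [Int.cast_neg, Int.cast_one, neg_mul, one_mul, ← sub_eq_add_neg]
      exact (D.southWest_translate hl).imp (hmono _) (hmono _))
  obtain ⟨l, hl⟩ := exists_moves_across hg hg' hne
  have hgl : ∀ s ∈ Icc (0 : ℝ) 1, g' s + (l : ℂ) ∉ F := fun s hs hsF ↦ by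
    obtain ⟨w, hw, hws⟩ : g' s ∈ D.param '' southWest := hg'.2 ▸ mem_image_of_mem g' hs
    exact hSW l ⟨w, hw, by rwa [hws]⟩
  exact hl ⟨(key l hgl).1, hgl, (key l hgl).2⟩

end FundamentalDomain

theorem proposition3p6 (G : WiringDiagram) (hG : ∃ F : Set ℂ, G.IsOrientedFace F)
    (D : FundamentalDomain G) : ¬ G.Admissible D := by
  rintro ⟨g, g', ops, hg, hg', hT, hAB⟩
  obtain ⟨F, hF⟩ := hG
  have hbdd := hF.1.2
  have hne : F.Nonempty := by
    obtain ⟨z, hz, hFz⟩ := hF.1.1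
    exact ⟨z, hFz ▸ mem_connectedComponentIn hz⟩
  have hAB' : (∀ op ∈ ops, op.type ≠ .A) ∨ ∀ op ∈ ops, op.type ≠ .B := by
    by_contra! hcon
    exact hAB hcon
  -- A face on the left cannot disappear without type A and cannot appear without type B; for a face
  -- on the right the types are exchanged.
  rcases hF.isOneSided with h | h <;> rcases hAB' with hops | hops
  · exact hT.false_of_not_disappear h hne hbdd hg hg' fun op ho ↦ Or.inl ⟨rfl, hops op ho⟩
  · exact hT.false_of_not_appear h hne hbdd hg hg' fun op ho ↦ Or.inl ⟨rfl, hops op ho⟩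
  · exact hT.false_of_not_appear h hne hbdd hg hg' fun op ho ↦ Or.inr ⟨rfl, hops op ho⟩
  · exact hT.false_of_not_disappear h hne hbdd hg hg' fun op ho ↦ Or.inr ⟨rfl, hops op ho⟩
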